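/- Let $n\ge 1$, $\Omega=\{-1,+1\}^n$, let $J\in\mathbb R^{n\times n}$ be symmetric, and let $\mathcal K$ be a symmetric stochastic $n\times n$ matrix. For $h\in\mathbb R^n$ let $$\mu_{J,h}(\sigma)=\frac1{Z_{J,h}}\exp\Big(\tfrac12\sum_{i,j}J_{i,j}\sigma_i\sigma_j+\sum_i h_i\sigma_i\Big),\qquad \sigma\in\Omega,$$ where $Z_{J,h}$ is the normalizing constant, and let $\mu_J=\mu_{J,0}$. For $\sigma\in\Omega$, $a=\pm1$, let $S_\ell(\sigma,a)$ be the configuration obtained from $\sigma$ by setting its $\ell$-th spin to $a$. For sites $\ell,k$ write $\sigma^*=S_\ell(\sigma,\sigma'_k)$, $\sigma'^*=S_k(\sigma',\sigma_\ell)$, and put $$p_J(\ell,k|\sigma,\sigma')=\frac{\mu_J(\sigma^*)\mu_J(\sigma'^*)}{\mu_J(\sigma)\mu_J(\sigma')+\mu_J(\sigma^*)\mu_J(\sigma'^*)},$$ $$\mathcal Q(\sigma,\sigma';\tau,\tau')=\frac1n\sum_{\ell,k}\mathcal K(\ell,k)\Big[p_J(\ell,k|\sigma,\sigma')\mathbf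 1(\tau=\sigma^*,\tau'=\sigma'^*)+(1-p_J(\ell,k|\sigma,\sigma'))\mathbf 1(\tau=\sigma,\tau'=\sigma')\Big].$$ Let $\mathcal P(\Omega)$ be the set of probability measures on $\Omega$, and let $$(p\circ q)(\tau)=\tfrac12\sum_{\sigma,\sigma',\tau'}\big(p(\sigma)q(\sigma')+p(\sigma')q(\sigma)\big)\mathcal Q(\sigma,\sigma';\tau,\tau').$$ Consider in $\mathcal P(\Omega)$ the equation $$\frac{dp_t}{dt}=p_t\circ p_t-p_t,\quad t\ge0,\qquad p_0=p. \tag{1}$$ Call $p$ stationary if the constant curve $p_t\equiv p$ solves (1). Let $\mathcal A$ be the partition of $[n]=\{1,\dots,n\}$ into the irreducible components (communicating classes) of $\mathcal K$, let $\Gamma_{\mathcal A}$ be the set of $h\in\mathbb R^n$ that are constant on every $A\in\mathcal A$, let $m(p,A)=\frac1{|A|}\sum_{\ell\in A}\sum_{\sigma}p(\sigma)\sigma_\ell$ and $m_{\mathcal A}(p)=(m(p,A))_{A\in\mathcal A}$. Call $p\in\mathcal P(\Omega)$ $\mathcal A$-regular if $m(p,A)\in(-1,1)$ for all $A\in\mathcal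 A$. Theorem. 1. For every $p\in\mathcal P(\Omega)$ the problem (1) has a unique solution $(p_t)_{t\ge0}$ in $\mathcal P(\Omega)$. 2. An $\mathcal A$-regular $p$ is stationary if and only if $p=\mu_{J,h}$ for some $h\in\Gamma_{\mathcal A}$. 3. For every $p\in\mathcal P(\Omega)$ and $A\in\mathcal A$, $m(p_t,A)=m(p,A)$ for all $t\ge0$. 4. For every $\mathcal A$-regular $p$ there is a unique $h\in\Gamma_{\mathcal A}$ with $m_{\mathcal A}(p)=m_{\mathcal A}(\mu_{J,h})$, and for this $h$, $\|p_t-\mu_{J,h}\|_{\rm TV}=\tfrac12\sum_\sigma|p_t(\sigma)-\mu_{J,h}(\sigma)|\to0$ as $t\to\infty$. -/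

import Mathlib

open Filter Topology

noncomputable section

namespace IsingKinetic

/-- Spin configurations `{-1, +1}ⁿ` (the units of `ℤ` are exactly `1` and `-1`). -/
abbrev Config (n : ℕ) : Type := Fin n → ℤˣ

/-- The spin `σ i ∈ {-1, +1}` as a real number. -/
def spin {n : ℕ} (σ : Config n) (i : Fin n) : ℝ := ((σ i : ℤ) : ℝ)

/-- `𝒫(Ω)`: probability vectors on the finite set of configurations. -/
abbrev Prob (n : ℕ) : Set (Config n → ℝ) := stdSimplex ℝ (Config n)

/-- The unnormalized Ising weight `exp(½ ∑ J i j σ i σ j + ∑ h i σ i)`. -/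
def isingWeight {n : ℕ} (J : Matrix (Fin n) (Fin n) ℝ) (h : Fin n → ℝ) (σ : Config n) : ℝ :=
  Real.exp ((1 / 2) * ∑ i, ∑ j, J i j * spin σ i * spin σ j + ∑ i, h i * spin σ i)

/-- The Gibbs measure `μ_{J,h}`. -/
def gibbs {n : ℕ} (J : Matrix (Fin n) (Fin n) ℝ) (h : Fin n → ℝ) (σ : Config n) : ℝ :=
  isingWeight J h σ / ∑ τ, isingWeight J h τ

/-- `S_ℓ(σ, a)`: replace the spin of `σ` at `ℓ` by `a`. -/
def setSpin {n : ℕ} (ℓ : Fin n) (σ : Config n) (a : ℤˣ) : Config n := Function.update σ ℓ a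

/-- The acceptance probability `p_J(ℓ, k | σ, σ')`. -/
def acceptProb {n : ℕ} (J : Matrix (Fin n) (Fin n) ℝ) (ℓ k : Fin n) (σ σ' : Config n) : ℝ :=
  (gibbs J 0 (setSpin ℓ σ (σ' k)) * gibbs J 0 (setSpin k σ' (σ ℓ))) /
    (gibbs J 0 σ * gibbs J 0 σ' +
      gibbs J 0 (setSpin ℓ σ (σ' k)) * gibbs J 0 (setSpin k σ' (σ ℓ)))

/-- The kernel `Q_J^{ℓ,k}(σ, σ'; τ, τ')`. -/
def exchangeKernel {n : ℕ} (J : Matrix (Fin n) (Fin n) ℝ) (ℓ k : Fin n)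
    (σ σ' τ τ' : Config n) : ℝ :=
  acceptProb J ℓ k σ σ' *
      (if τ = setSpin ℓ σ (σ' k) ∧ τ' = setSpin k σ' (σ ℓ) then 1 else 0) +
    (1 - acceptProb J ℓ k σ σ') * (if τ = σ ∧ τ' = σ' then 1 else 0)

/-- The collision kernel `𝒬_J^𝒦(σ, σ'; τ, τ')`. -/
def collisionKernel {n : ℕ} (J K : Matrix (Fin n) (Fin n) ℝ) (σ σ' τ τ' : Config n) : ℝ :=
  (1 / (n : ℝ)) * ∑ ℓ, ∑ k, K ℓ k * exchangeKernel J ℓ k σ σ' τ τ'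

/-- The commutative collision product `p ∘ q`. -/
def collide {n : ℕ} (J K : Matrix (Fin n) (Fin n) ℝ) (p q : Config n → ℝ) (τ : Config n) : ℝ :=
  (1 / 2) * ∑ σ, ∑ σ', ∑ τ',
    (p σ * q σ' + p σ' * q σ) * collisionKernel J K σ σ' τ τ'

/-- `u` solves `dp_t/dt = p_t ∘ p_t - p_t` in `𝒫(Ω)` for `t ≥ 0`, with `p_0 = p`
(one-sided derivative at `t = 0`; values at negative times are irrelevant). -/
structure IsSolution {n : ℕ} (J K : Matrix (Fin n) (Fin n) ℝ) (p : Config n → ℝ)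
    (u : ℝ → Config n → ℝ) : Prop where
  mem_prob : ∀ t, 0 ≤ t → u t ∈ Prob n
  initial : u 0 = p
  deriv : ∀ t, 0 ≤ t →
    HasDerivWithinAt u (collide J K (u t) (u t) - u t) (Set.Ici 0) t

/-- `p` is stationary: the solution started at `p` is `p_t ≡ p`. -/
def IsStationaryState {n : ℕ} (J K : Matrix (Fin n) (Fin n) ℝ) (p : Config n → ℝ) : Prop :=
  IsSolution J K p (fun _ => p)

/-- Two sites communicate when each is accessible from the other along a (possibly empty) path of
positive transition probabilities. -/
def communication {n : ℕ} (K : Matrix (Fin n) (Fin n) ℝ) : Setoid (Fin n) where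
  r i j := Relation.ReflTransGen (fun a b => 0 < K a b) i j ∧
    Relation.ReflTransGen (fun a b => 0 < K a b) j i
  iseqv := ⟨fun _ => ⟨.refl, .refl⟩, fun h => ⟨h.2, h.1⟩,
    fun h h' => ⟨h.1.trans h'.1, h'.2.trans h.2⟩⟩

open Classical in
/-- The partition of the sites into the irreducible components of `K`. -/
def components {n : ℕ} (K : Matrix (Fin n) (Fin n) ℝ) :
    Finpartition (Finset.univ : Finset (Fin n)) :=
  Finpartition.ofSetoid (communication K)

/-- `m(p, A)`: the mean magnetization of `p` in the block `A`. -/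
def magnetization {n : ℕ} (p : Config n → ℝ) (A : Finset (Fin n)) : ℝ :=
  (1 / (A.card : ℝ)) * ∑ ℓ ∈ A, ∑ σ, p σ * spin σ ℓ

/-- `m_𝒜(p) = (m(p, A))_{A ∈ 𝒜}`: the magnetization profile. -/
def magProfile {n : ℕ} (𝒜 : Finpartition (Finset.univ : Finset (Fin n))) (p : Config n → ℝ) :
    𝒜.parts → ℝ :=
  fun A => magnetization p A.1

/-- `𝒫_𝒜(Ω)`: the `𝒜`-regular probability vectors. -/
def RegularProb {n : ℕ} (𝒜 : Finpartition (Finset.univ : Finset (Fin n))) :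
    Set (Config n → ℝ) :=
  {p | p ∈ Prob n ∧ ∀ A : 𝒜.parts, magProfile 𝒜 p A ∈ Set.Ioo (-1 : ℝ) 1}

/-- `Γ_𝒜`: the external fields that are constant on every block of `𝒜`. -/
def BlockFields {n : ℕ} (𝒜 : Finpartition (Finset.univ : Finset (Fin n))) : Set (Fin n → ℝ) :=
  {h | ∀ A ∈ 𝒜.parts, ∀ i ∈ A, ∀ j ∈ A, h i = h j}

/-- Total variation distance of two probability vectors. -/
def tvDist {n : ℕ} (p q : Config n → ℝ) : ℝ := (1 / 2) * ∑ σ, |p σ - q σ|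

end IsingKinetic

end

open IsingKinetic

/-! Each exchange is an involution of pairs of configurations, and its acceptance rule is reversible
for `μ_J ⊗ μ_J`. Tested against an observable `g`, the vector field `p ∘ p - p` is therefore a
negative multiple of a bilinear `dissipation` form (`sum_collide_sub_mul`). Two consequences follow.
Observables whose pair sum survives all allowed exchanges are conserved, in particular the
magnetization of each component. With `g = log (p / μ_J)` every term has the form `(a - b)(log a -
log b) ≥ 0`, so the free energy decreases (an H-theorem).

Zero entropy production at a positive state forces detailed balance. Then `log (p / μ_J)` changes
under a spin flip by an amount depending only on the component of the site, so `p` is a Gibbs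
measure with a block field (`exists_field_of_pairDensity`). That field is determined by the
magnetization profile (`field_eq_of_magProfile`). A regular state may have zeros, but the flow makes
all coordinates positive at once (`IsSolution.pos`).

Everything meets in `IsSolution.exists_field_of_freeEnergy_le`: a regular state whose free energy
does not drop in unit time is Gibbs. It applies to a stationary state, to a minimizer of the free
energy at fixed profile (existence of `h`), and to any limit point of a trajectory (LaSalle's
principle, hence convergence). -/

namespace IsingKinetic

variable {n : ℕ}

/-! ### Exchanges and acceptance probabilities -/

/-- The exchange of the spin of the first configuration at `ℓ` with that of the second at `k`. -/
def exchange (ℓ k : Fin n) (z : Config n × Config n) : Config n × Config n :=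
  (setSpin ℓ z.1 (z.2 k), setSpin k z.2 (z.1 ℓ))

theorem exchange_involutive (ℓ k : Fin n) : Function.Involutive (exchange ℓ k) := by
  rintro ⟨σ, σ'⟩
  simp [exchange, setSpin]

theorem exchange_swap (ℓ k : Fin n) (z : Config n × Config n) :
    exchange k ℓ z.swap = (exchange ℓ k z).swap := rfl

theorem isingWeight_pos (J : Matrix (Fin n) (Fin n) ℝ) (h : Fin n → ℝ) (σ : Config n) :
    0 < isingWeight J h σ := Real.exp_pos _

theorem partition_pos (J : Matrix (Fin n) (Fin n) ℝ) (h : Fin n → ℝ) :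
    0 < ∑ τ, isingWeight J h τ :=
  Finset.sum_pos (fun τ _ => isingWeight_pos J h τ) Finset.univ_nonempty

theorem gibbs_pos (J : Matrix (Fin n) (Fin n) ℝ) (h : Fin n → ℝ) (σ : Config n) :
    0 < gibbs J h σ := div_pos (isingWeight_pos J h σ) (partition_pos J h)

theorem gibbs_mem_prob (J : Matrix (Fin n) (Fin n) ℝ) (h : Fin n → ℝ) :
    gibbs J h ∈ Prob n := by
  refine ⟨fun σ => (gibbs_pos J h σ).le, ?_⟩
  simp only [gibbs, ← Finset.sum_div]
  exact div_self (partition_pos J h).ne'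

theorem acceptProb_nonneg (J : Matrix (Fin n) (Fin n) ℝ) (ℓ k : Fin n) (σ σ' : Config n) :
    0 ≤ acceptProb J ℓ k σ σ' := by
  have := gibbs_pos J 0
  unfold acceptProb
  exact div_nonneg (mul_pos (this _) (this _)).le
    (add_pos (mul_pos (this _) (this _)) (mul_pos (this _) (this _))).le

theorem acceptProb_pos (J : Matrix (Fin n) (Fin n) ℝ) (ℓ k : Fin n) (σ σ' : Config n) :
    0 < acceptProb J ℓ k σ σ' := by
  have := gibbs_pos J 0
  unfold acceptProb
  exact div_pos (mul_pos (this _) (this _))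
    (add_pos (mul_pos (this _) (this _)) (mul_pos (this _) (this _)))

theorem acceptProb_le_one (J : Matrix (Fin n) (Fin n) ℝ) (ℓ k : Fin n) (σ σ' : Config n) :
    acceptProb J ℓ k σ σ' ≤ 1 := by
  have := gibbs_pos J 0
  unfold acceptProb
  refine div_le_one_of_le₀ ?_
    (add_pos (mul_pos (this _) (this _)) (mul_pos (this _) (this _))).le
  linarith [mul_pos (this σ) (this σ')]

theorem acceptProb_comm (J : Matrix (Fin n) (Fin n) ℝ) (ℓ k : Fin n) (σ σ' : Config n) :
    acceptProb J k ℓ σ' σ = acceptProb J ℓ k σ σ' := by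
  unfold acceptProb
  congr 1 <;> ring

/-! ### The collision product in weak form -/

theorem collide_self (J K : Matrix (Fin n) (Fin n) ℝ) (x : Config n → ℝ) (τ : Config n) :
    collide J K x x τ =
      ∑ σ, ∑ σ', ∑ τ', x σ * x σ' * collisionKernel J K σ σ' τ τ' := by
  simp only [collide, Finset.mul_sum]
  refine Finset.sum_congr rfl fun σ _ => Finset.sum_congr rfl fun σ' _ =>
    Finset.sum_congr rfl fun τ' _ => ?_
  ring

theorem sum_exchangeKernel_mul (J : Matrix (Fin n) (Fin n) ℝ) (ℓ k : Fin n) (σ σ' : Config n)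
    (g : Config n → ℝ) :
    ∑ τ, ∑ τ', exchangeKernel J ℓ k σ σ' τ τ' * g τ =
      acceptProb J ℓ k σ σ' * g (setSpin ℓ σ (σ' k)) + (1 - acceptProb J ℓ k σ σ') * g σ := by
  have key : ∀ (c : ℝ) (a b : Config n),
      ∑ τ, ∑ τ', c * (if τ = a ∧ τ' = b then (1 : ℝ) else 0) * g τ = c * g a := by
    intro c a b
    rw [Finset.sum_eq_single a, Finset.sum_eq_single b]
    · simp
    · intro τ' _ h; simp [h]
    · simp
    · intro τ _ h; simp [h]
    · simp
  simp only [exchangeKernel, add_mul, Finset.sum_add_distrib, key]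

/-- The collision product tested against an observable. -/
theorem sum_collide_mul (J K : Matrix (Fin n) (Fin n) ℝ) (x g : Config n → ℝ) :
    ∑ τ, collide J K x x τ * g τ =
      (1 / (n : ℝ)) * ∑ ℓ, ∑ k, K ℓ k * ∑ z : Config n × Config n, x z.1 * x z.2 *
        (acceptProb J ℓ k z.1 z.2 * g (exchange ℓ k z).1 +
          (1 - acceptProb J ℓ k z.1 z.2) * g z.1) := by
  have h1 : ∀ σ σ', ∑ τ, ∑ τ', collisionKernel J K σ σ' τ τ' * g τ =
      (1 / (n : ℝ)) * ∑ ℓ, ∑ k, K ℓ k * (acceptProb J ℓ k σ σ' * g (setSpin ℓ σ (σ' k)) +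
        (1 - acceptProb J ℓ k σ σ') * g σ) := by
    intro σ σ'
    simp only [← sum_exchangeKernel_mul, collisionKernel, Finset.mul_sum, Finset.sum_mul]
    calc _ = ∑ τ, ∑ ℓ, ∑ τ', ∑ k, _ := Finset.sum_congr rfl fun τ _ => Finset.sum_comm
      _ = ∑ ℓ, ∑ τ, ∑ τ', ∑ k, _ := Finset.sum_comm
      _ = ∑ ℓ, ∑ τ, ∑ k, ∑ τ', _ := Finset.sum_congr rfl fun τ _ =>
          Finset.sum_congr rfl fun _ _ => Finset.sum_comm
      _ = ∑ ℓ, ∑ k, ∑ τ, ∑ τ', _ := Finset.sum_congr rfl fun τ _ => Finset.sum_comm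
      _ = _ := by
        refine Finset.sum_congr rfl fun _ _ => Finset.sum_congr rfl fun _ _ =>
          Finset.sum_congr rfl fun _ _ => Finset.sum_congr rfl fun _ _ => ?_
        ring
  calc ∑ τ, collide J K x x τ * g τ
      = ∑ τ, ∑ σ, ∑ σ', x σ * x σ' * ∑ τ', collisionKernel J K σ σ' τ τ' * g τ := by
        simp only [collide_self, Finset.sum_mul, Finset.mul_sum]
        refine Finset.sum_congr rfl fun _ _ => Finset.sum_congr rfl fun _ _ =>
          Finset.sum_congr rfl fun _ _ => Finset.sum_congr rfl fun _ _ => ?_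
        ring
    _ = ∑ σ, ∑ σ', x σ * x σ' * ∑ τ, ∑ τ', collisionKernel J K σ σ' τ τ' * g τ := by
        rw [Finset.sum_comm]
        refine Finset.sum_congr rfl fun _ _ => ?_
        rw [Finset.sum_comm]
        refine Finset.sum_congr rfl fun _ _ => ?_
        rw [Finset.mul_sum]
    _ = ∑ z : Config n × Config n, x z.1 * x z.2 * ((1 / (n : ℝ)) * ∑ ℓ, ∑ k, K ℓ k *
          (acceptProb J ℓ k z.1 z.2 * g (setSpin ℓ z.1 (z.2 k)) +
          (1 - acceptProb J ℓ k z.1 z.2) * g z.1)) := by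
        simp only [h1, Fintype.sum_prod_type]
    _ = _ := by
        simp only [Finset.mul_sum]
        rw [Finset.sum_comm]
        refine Finset.sum_congr rfl fun _ _ => ?_
        rw [Finset.sum_comm]
        refine Finset.sum_congr rfl fun _ _ => Finset.sum_congr rfl fun _ _ => ?_
        simp only [exchange]
        ring

theorem collide_eq (J K : Matrix (Fin n) (Fin n) ℝ) (x : Config n → ℝ) (τ : Config n) :
    collide J K x x τ =
      (1 / (n : ℝ)) * ∑ ℓ, ∑ k, K ℓ k * ∑ z : Config n × Config n, x z.1 * x z.2 *
        (acceptProb J ℓ k z.1 z.2 * (if (exchange ℓ k z).1 = τ then 1 else 0) +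
          (1 - acceptProb J ℓ k z.1 z.2) * (if z.1 = τ then 1 else 0)) := by
  rw [← sum_collide_mul J K x (fun σ => if σ = τ then 1 else 0)]
  simp

theorem collide_term_nonneg (J : Matrix (Fin n) (Fin n) ℝ) {x : Config n → ℝ} (hx : ∀ σ, 0 ≤ x σ)
    (τ : Config n) (ℓ k : Fin n) (z : Config n × Config n) : 0 ≤ x z.1 * x z.2 *
      (acceptProb J ℓ k z.1 z.2 * (if (exchange ℓ k z).1 = τ then 1 else 0) +
        (1 - acceptProb J ℓ k z.1 z.2) * (if z.1 = τ then 1 else 0)) := by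
  refine mul_nonneg (mul_nonneg (hx _) (hx _)) (add_nonneg (mul_nonneg (acceptProb_nonneg ..) ?_)
    (mul_nonneg (sub_nonneg.2 (acceptProb_le_one ..)) ?_)) <;> split_ifs <;> norm_num

theorem collide_nonneg {J K : Matrix (Fin n) (Fin n) ℝ} (hK : ∀ i j, 0 ≤ K i j)
    {x : Config n → ℝ} (hx : ∀ σ, 0 ≤ x σ) (τ : Config n) : 0 ≤ collide J K x x τ := by
  rw [collide_eq]
  exact mul_nonneg (by positivity) (Finset.sum_nonneg fun ℓ _ => Finset.sum_nonneg fun k _ =>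
    mul_nonneg (hK _ _) (Finset.sum_nonneg fun z _ => collide_term_nonneg J hx τ ℓ k z))

theorem collide_pos_of_exchange (hn : 0 < n) {J K : Matrix (Fin n) (Fin n) ℝ}
    (hK : ∀ i j, 0 ≤ K i j) {x : Config n → ℝ} (hx : ∀ σ, 0 ≤ x σ) {ℓ k : Fin n}
    (hℓk : 0 < K ℓ k) {z : Config n × Config n} (h1 : 0 < x z.1) (h2 : 0 < x z.2) :
    0 < collide J K x x (exchange ℓ k z).1 := by
  rw [collide_eq]
  have hn' : (0 : ℝ) < n := by exact_mod_cast hn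
  have hin := fun i j => mul_nonneg (hK i j) (Finset.sum_nonneg (s := Finset.univ) fun w _ =>
    collide_term_nonneg J hx (exchange ℓ k z).1 i j w)
  refine mul_pos (by positivity) (Finset.sum_pos' (fun i _ => Finset.sum_nonneg fun j _ => hin i j)
    ⟨ℓ, Finset.mem_univ _, Finset.sum_pos' (fun j _ => hin ℓ j) ⟨k, Finset.mem_univ _,
      mul_pos hℓk (Finset.sum_pos' (fun w _ => collide_term_nonneg J hx _ ℓ k w)
        ⟨z, Finset.mem_univ _, ?_⟩)⟩⟩)
  rw [if_pos rfl, mul_one]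
  refine mul_pos (mul_pos h1 h2) (add_pos_of_pos_of_nonneg (acceptProb_pos ..)
    (mul_nonneg (sub_nonneg.2 (acceptProb_le_one ..)) ?_))
  split_ifs <;> norm_num

theorem sum_pair_mul (x g : Config n → ℝ) :
    ∑ z : Config n × Config n, x z.1 * x z.2 * g z.1 = (∑ σ, x σ) * ∑ σ, x σ * g σ := by
  rw [Fintype.sum_prod_type, Finset.mul_sum]
  refine Finset.sum_congr rfl fun σ _ => ?_
  rw [Finset.sum_mul]
  exact Finset.sum_congr rfl fun σ' _ => by ring

/-- The collision product in weak form: gain of an observable under accepted exchanges. -/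
theorem sum_collide_mul_sub (hn : 0 < n) (J : Matrix (Fin n) (Fin n) ℝ)
    {K : Matrix (Fin n) (Fin n) ℝ} (hK : ∀ i, ∑ j, K i j = 1) (x g : Config n → ℝ) :
    ∑ τ, collide J K x x τ * g τ = (∑ σ, x σ) * ∑ σ, x σ * g σ +
      (1 / (n : ℝ)) * ∑ ℓ, ∑ k, K ℓ k * ∑ z : Config n × Config n, x z.1 * x z.2 *
        acceptProb J ℓ k z.1 z.2 * (g (exchange ℓ k z).1 - g z.1) := by
  have hn' : (n : ℝ) ≠ 0 := by exact_mod_cast hn.ne'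
  rw [sum_collide_mul]
  have : ∀ ℓ k, K ℓ k * ∑ z : Config n × Config n, x z.1 * x z.2 *
        (acceptProb J ℓ k z.1 z.2 * g (exchange ℓ k z).1 +
          (1 - acceptProb J ℓ k z.1 z.2) * g z.1) =
      K ℓ k * ((∑ σ, x σ) * ∑ σ, x σ * g σ) + K ℓ k * ∑ z : Config n × Config n, x z.1 * x z.2 *
        acceptProb J ℓ k z.1 z.2 * (g (exchange ℓ k z).1 - g z.1) := by
    intro ℓ k
    rw [← sum_pair_mul, ← mul_add, ← Finset.sum_add_distrib]
    congr 1
    exact Finset.sum_congr rfl fun z _ => by ring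
  simp only [this, Finset.sum_add_distrib, ← Finset.sum_mul, hK, Finset.sum_const,
    Finset.card_univ, Fintype.card_fin, nsmul_eq_mul, mul_one]
  field_simp

/-- The total mass is left free because the truncated equation used for existence is not known in
advance to conserve mass. -/
theorem sum_collide (hn : 0 < n) (J : Matrix (Fin n) (Fin n) ℝ)
    {K : Matrix (Fin n) (Fin n) ℝ} (hK : ∀ i, ∑ j, K i j = 1) (x : Config n → ℝ) :
    ∑ τ, collide J K x x τ = (∑ σ, x σ) ^ 2 := by
  have := sum_collide_mul_sub hn J hK x (fun _ => 1)
  simpa [pow_two] using this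

/-! ### Reversibility and the dissipation form -/

/-- The symmetric edge weight of an exchange. -/
noncomputable def exchangeWeight (J : Matrix (Fin n) (Fin n) ℝ) (ℓ k : Fin n)
    (z : Config n × Config n) : ℝ :=
  gibbs J 0 z.1 * gibbs J 0 z.2 * (gibbs J 0 (exchange ℓ k z).1 * gibbs J 0 (exchange ℓ k z).2) /
    (gibbs J 0 z.1 * gibbs J 0 z.2 +
      gibbs J 0 (exchange ℓ k z).1 * gibbs J 0 (exchange ℓ k z).2)

theorem exchangeWeight_pos (J : Matrix (Fin n) (Fin n) ℝ) (ℓ k : Fin n)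
    (z : Config n × Config n) : 0 < exchangeWeight J ℓ k z := by
  have := gibbs_pos J 0
  unfold exchangeWeight
  exact div_pos (mul_pos (mul_pos (this _) (this _)) (mul_pos (this _) (this _)))
    (add_pos (mul_pos (this _) (this _)) (mul_pos (this _) (this _)))

theorem exchangeWeight_exchange (J : Matrix (Fin n) (Fin n) ℝ) (ℓ k : Fin n)
    (z : Config n × Config n) : exchangeWeight J ℓ k (exchange ℓ k z) = exchangeWeight J ℓ k z := by
  unfold exchangeWeight
  rw [exchange_involutive ℓ k z]
  congr 1 <;> ring

/-- The density of the product `x ⊗ x` with respect to `μ_J ⊗ μ_J`. -/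
noncomputable def pairDensity (J : Matrix (Fin n) (Fin n) ℝ) (x : Config n → ℝ)
    (z : Config n × Config n) : ℝ :=
  x z.1 / gibbs J 0 z.1 * (x z.2 / gibbs J 0 z.2)

/-- This is reversibility: the flux through an exchange is an exchange-invariant weight times the
density of the pair, so only the density distinguishes the two directions. -/
theorem mul_acceptProb (J : Matrix (Fin n) (Fin n) ℝ) (x : Config n → ℝ) (ℓ k : Fin n)
    (z : Config n × Config n) :
    x z.1 * x z.2 * acceptProb J ℓ k z.1 z.2 = exchangeWeight J ℓ k z * pairDensity J x z := by
  have h1 := (gibbs_pos J 0 z.1).ne'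
  have h2 := (gibbs_pos J 0 z.2).ne'
  unfold acceptProb exchangeWeight pairDensity exchange
  field_simp

/-- The dissipation form of the dynamics. -/
noncomputable def dissipation (J K : Matrix (Fin n) (Fin n) ℝ) (x g : Config n → ℝ) : ℝ :=
  ∑ ℓ, ∑ k, K ℓ k * ∑ z : Config n × Config n, exchangeWeight J ℓ k z *
    ((pairDensity J x z - pairDensity J x (exchange ℓ k z)) *
      (g z.1 + g z.2 - (g (exchange ℓ k z).1 + g (exchange ℓ k z).2)))

theorem sum_exchange_symm (J : Matrix (Fin n) (Fin n) ℝ) (x g : Config n → ℝ) (ℓ k : Fin n) :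
    ∑ z : Config n × Config n, exchangeWeight J ℓ k z *
      ((pairDensity J x z - pairDensity J x (exchange ℓ k z)) *
        (g z.1 + g z.2 - (g (exchange ℓ k z).1 + g (exchange ℓ k z).2))) =
    -2 * ∑ z : Config n × Config n, x z.1 * x z.2 * acceptProb J ℓ k z.1 z.2 *
      (g (exchange ℓ k z).1 + g (exchange ℓ k z).2 - (g z.1 + g z.2)) := by
  -- Reindexing by the involution reverses the sign of the increment of `g`; averaging both versions
  -- produces the density difference.
  have h := Equiv.sum_comp (exchange_involutive ℓ k).toPerm (fun z =>
    exchangeWeight J ℓ k z * pairDensity J x z *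
      (g (exchange ℓ k z).1 + g (exchange ℓ k z).2 - (g z.1 + g z.2)))
  simp only [Function.Involutive.coe_toPerm, exchangeWeight_exchange,
    exchange_involutive ℓ k _] at h
  simp only [mul_acceptProb]
  rw [neg_mul, two_mul]
  nth_rw 1 [← h]
  rw [← Finset.sum_add_distrib, ← Finset.sum_neg_distrib]
  exact Finset.sum_congr rfl fun z _ => by ring

/-- The constant 4 collects two symmetrizations: a factor 2 from swapping the two particles, which
uses the symmetry of `K`, and a factor 2 from the exchange involution. -/
theorem sum_collide_sub_mul (hn : 0 < n) (J : Matrix (Fin n) (Fin n) ℝ)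
    {K : Matrix (Fin n) (Fin n) ℝ} (hKs : K.IsSymm) (hK : ∀ i, ∑ j, K i j = 1)
    {x : Config n → ℝ} (hx : ∑ σ, x σ = 1) (g : Config n → ℝ) :
    ∑ τ, (collide J K x x τ - x τ) * g τ = -(1 / (4 * (n : ℝ))) * dissipation J K x g := by
  have hn' : (n : ℝ) ≠ 0 := by exact_mod_cast hn.ne'
  set B : Fin n → Fin n → ℝ := fun ℓ k => ∑ z : Config n × Config n, x z.1 * x z.2 *
        acceptProb J ℓ k z.1 z.2 * (g (exchange ℓ k z).1 - g z.1) with hB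
  set B' : Fin n → Fin n → ℝ := fun ℓ k => ∑ z : Config n × Config n, x z.1 * x z.2 *
        acceptProb J ℓ k z.1 z.2 * (g (exchange ℓ k z).2 - g z.2) with hB'
  have hBB : ∀ ℓ k, B k ℓ = B' ℓ k := by
    intro ℓ k
    simp only [hB, hB']
    rw [← Equiv.sum_comp (Equiv.prodComm _ _)]
    refine Finset.sum_congr rfl fun z _ => ?_
    rw [Equiv.prodComm_apply, exchange_swap, ← acceptProb_comm J ℓ k]
    simp only [Prod.fst_swap, Prod.snd_swap]
    ring
  have h1 : ∑ ℓ, ∑ k, K ℓ k * B ℓ k = ∑ ℓ, ∑ k, K ℓ k * B' ℓ k := by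
    rw [Finset.sum_comm]
    refine Finset.sum_congr rfl fun ℓ _ => Finset.sum_congr rfl fun k _ => ?_
    rw [hBB, hKs.apply]
  have h2 : dissipation J K x g = -2 * (∑ ℓ, ∑ k, K ℓ k * B ℓ k + ∑ ℓ, ∑ k, K ℓ k * B' ℓ k) := by
    simp only [dissipation, sum_exchange_symm, ← Finset.sum_add_distrib, Finset.mul_sum, hB, hB']
    refine Finset.sum_congr rfl fun ℓ _ => Finset.sum_congr rfl fun k _ =>
      Finset.sum_congr rfl fun z _ => by ring
  simp only [sub_mul, Finset.sum_sub_distrib]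
  rw [sum_collide_mul_sub hn J hK, hx, h2, ← h1]
  field_simp
  ring

/-- Observables whose pair sum is preserved by every allowed exchange are conserved. -/
theorem sum_collide_sub_mul_eq_zero (hn : 0 < n) (J : Matrix (Fin n) (Fin n) ℝ)
    {K : Matrix (Fin n) (Fin n) ℝ} (hKs : K.IsSymm) (hK : ∀ i, ∑ j, K i j = 1)
    {x : Config n → ℝ} (hx : ∑ σ, x σ = 1) {g : Config n → ℝ}
    (hg : ∀ ℓ k, K ℓ k ≠ 0 → ∀ z, g (exchange ℓ k z).1 + g (exchange ℓ k z).2 = g z.1 + g z.2) :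
    ∑ τ, (collide J K x x τ - x τ) * g τ = 0 := by
  rw [sum_collide_sub_mul hn J hKs hK hx]
  suffices dissipation J K x g = 0 by rw [this, mul_zero]
  refine Finset.sum_eq_zero fun ℓ _ => Finset.sum_eq_zero fun k _ => ?_
  by_cases h : K ℓ k = 0
  · simp [h]
  · simp [hg ℓ k h]

/-- Detailed balance implies stationarity. -/
theorem collide_eq_self_of_pairDensity (hn : 0 < n) {J : Matrix (Fin n) (Fin n) ℝ}
    {K : Matrix (Fin n) (Fin n) ℝ} (hKs : K.IsSymm) (hK : ∀ i, ∑ j, K i j = 1)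
    {x : Config n → ℝ} (hx : ∑ σ, x σ = 1)
    (hr : ∀ ℓ k, K ℓ k ≠ 0 → ∀ z, pairDensity J x (exchange ℓ k z) = pairDensity J x z) :
    collide J K x x = x := by
  funext τ
  have h := sum_collide_sub_mul hn J hKs hK hx (fun σ => if σ = τ then 1 else 0)
  have h0 : dissipation J K x (fun σ => if σ = τ then 1 else 0) = 0 := by
    refine Finset.sum_eq_zero fun ℓ _ => Finset.sum_eq_zero fun k _ => ?_
    by_cases h : K ℓ k = 0
    · simp [h]
    · simp [hr ℓ k h]
  rw [h0, mul_zero] at h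
  simpa [sub_eq_zero] using h

/-! ### Irreducible components and closure under exchanges -/

theorem rel_of_mem_block {K : Matrix (Fin n) (Fin n) ℝ} {A : Finset (Fin n)}
    (hA : A ∈ (components K).parts) {i j : Fin n} (hi : i ∈ A) :
    j ∈ A ↔ communication K i j := by
  classical
  have h1 : (components K).part i = A := (components K).part_eq_of_mem hA hi
  rw [← h1]
  unfold components
  rw [Finpartition.mem_part_ofSetoid_iff_rel]

theorem communication_of_pos {K : Matrix (Fin n) (Fin n) ℝ} (hKs : K.IsSymm) {i j : Fin n}
    (h : 0 < K i j) : communication K i j :=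
  ⟨.single h, .single (by rwa [hKs.apply])⟩

theorem mem_block_iff_of_pos {K : Matrix (Fin n) (Fin n) ℝ} (hKs : K.IsSymm)
    {A : Finset (Fin n)} (hA : A ∈ (components K).parts) {i j : Fin n} (h : 0 < K i j) :
    i ∈ A ↔ j ∈ A :=
  ⟨fun hi => (rel_of_mem_block hA hi).2 (communication_of_pos hKs h),
    fun hj => (rel_of_mem_block hA hj).2 (communication_of_pos hKs (by rwa [hKs.apply]))⟩

theorem exists_block (K : Matrix (Fin n) (Fin n) ℝ) (i : Fin n) :
    ∃ A ∈ (components K).parts, i ∈ A :=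
  ⟨_, (components K).part_mem.2 (Finset.mem_univ i), (components K).mem_part (Finset.mem_univ i)⟩

theorem exists_pos_of_sum_eq_one {K : Matrix (Fin n) (Fin n) ℝ} (hK : ∀ i, ∑ j, K i j = 1)
    (ℓ : Fin n) : ∃ k, 0 < K ℓ k := by
  by_contra! h
  linarith [hK ℓ, Finset.sum_nonpos fun k (_ : k ∈ Finset.univ) => h k]

theorem mem_of_forall_update_mem {S : Set (Config n)}
    (hS : ∀ σ ∈ S, ∀ i a, Function.update σ i a ∈ S) {σ : Config n} (hσ : σ ∈ S)
    (τ : Config n) : τ ∈ S := by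
  suffices ∀ s : Finset (Fin n), s.piecewise τ σ ∈ S by simpa using this Finset.univ
  intro s
  induction s using Finset.induction_on with
  | empty => simpa
  | insert i s _ ih =>
    rw [Finset.piecewise_insert]
    exact hS _ ih _ _

/-- A set of configurations that is closed under exchanges and sees both spin values in each
irreducible component contains every configuration. -/
theorem mem_of_exchange_closed (hn : 0 < n) {K : Matrix (Fin n) (Fin n) ℝ} (hKs : K.IsSymm)
    (hK : ∀ i, ∑ j, K i j = 1) {S : Set (Config n)}
    (hcl : ∀ ℓ k, 0 < K ℓ k → ∀ σ ∈ S, ∀ σ' ∈ S, setSpin ℓ σ (σ' k) ∈ S)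
    (hspin : ∀ A ∈ (components K).parts, ∀ a : ℤˣ, ∃ ℓ ∈ A, ∃ σ ∈ S, σ ℓ = a)
    (τ : Config n) : τ ∈ S := by
  have hall : ∀ (ℓ : Fin n) (a : ℤˣ), ∃ σ ∈ S, σ ℓ = a := by
    intro ℓ a
    obtain ⟨A, hA, hℓ⟩ := exists_block K ℓ
    obtain ⟨k, hk, σ, hσ, hσk⟩ := hspin A hA a
    have hreach := ((rel_of_mem_block hA hk).1 hℓ).1
    clear hℓ
    induction hreach with
    | refl => exact ⟨σ, hσ, hσk⟩
    -- Exchanging a configuration with a copy of itself copies the spin at one site onto a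
    -- neighbouring site, so spin values travel along paths of `K`.
    | tail _ hbc ih =>
      obtain ⟨σ', hσ', rfl⟩ := ih
      exact ⟨_, hcl _ _ (by rwa [hKs.apply]) σ' hσ' σ' hσ', by simp [setSpin]⟩
  obtain ⟨σ, hσ, -⟩ := hall ⟨0, hn⟩ 1
  -- Any single-spin update is an exchange with a partner carrying the desired value at a neighbour
  -- `k` of `i`.
  refine mem_of_forall_update_mem (fun σ hσ i a => ?_) hσ τ
  obtain ⟨k, hk⟩ := exists_pos_of_sum_eq_one hK i
  obtain ⟨σ', hσ', rfl⟩ := hall k a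
  exact hcl i k hk σ hσ σ' hσ'

/-! ### Block fields, Gibbs measures and detailed balance -/

theorem sum_field_update (h : Fin n → ℝ) (σ : Config n) (ℓ : Fin n) (a : ℤˣ) :
    ∑ i, h i * spin (Function.update σ ℓ a) i =
      ∑ i, h i * spin σ i + h ℓ * (((a : ℤ) : ℝ) - spin σ ℓ) := by
  rw [← sub_eq_iff_eq_add', ← Finset.sum_sub_distrib, Finset.sum_eq_single ℓ]
  · simp [spin]; ring
  · intro i _ hi
    simp [spin, hi]
  · simp

/-- The two spins only change places, between sites of equal field. This gives both the conservation
laws and detailed balance for Gibbs measures. -/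
theorem sum_field_exchange {h : Fin n → ℝ} {ℓ k : Fin n} (hℓk : h ℓ = h k)
    (z : Config n × Config n) :
    ∑ i, h i * spin (exchange ℓ k z).1 i + ∑ i, h i * spin (exchange ℓ k z).2 i =
      ∑ i, h i * spin z.1 i + ∑ i, h i * spin z.2 i := by
  simp only [exchange, setSpin, sum_field_update, hℓk]
  simp only [spin]
  ring

theorem isingWeight_eq (J : Matrix (Fin n) (Fin n) ℝ) (h : Fin n → ℝ) (σ : Config n) :
    isingWeight J h σ = isingWeight J 0 σ * Real.exp (∑ i, h i * spin σ i) := by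
  simp [isingWeight, Real.exp_add]

theorem eq_gibbs_of_eq_mul {J : Matrix (Fin n) (Fin n) ℝ} {h : Fin n → ℝ} {q : Config n → ℝ}
    (hq : ∑ σ, q σ = 1) (c : ℝ) (hc : ∀ σ, q σ = c * isingWeight J h σ) : q = gibbs J h := by
  have h1 : c * ∑ σ, isingWeight J h σ = 1 := by
    rw [Finset.mul_sum, ← hq]
    exact Finset.sum_congr rfl fun σ _ => (hc σ).symm
  funext σ
  rw [hc, gibbs, eq_div_iff (partition_pos J h).ne', mul_right_comm, h1, one_mul]

theorem gibbs_div_gibbs (J : Matrix (Fin n) (Fin n) ℝ) (h : Fin n → ℝ) (σ : Config n) :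
    gibbs J h σ / gibbs J 0 σ = (∑ τ, isingWeight J 0 τ) / (∑ τ, isingWeight J h τ) *
      Real.exp (∑ i, h i * spin σ i) := by
  have h1 := (partition_pos J h).ne'
  have h2 := (partition_pos J 0).ne'
  have h3 := (isingWeight_pos J 0 σ).ne'
  rw [gibbs, gibbs, isingWeight_eq J h σ]
  field_simp

theorem field_eq_of_ne_zero {K : Matrix (Fin n) (Fin n) ℝ} (hKs : K.IsSymm)
    (hK0 : ∀ i j, 0 ≤ K i j) {h : Fin n → ℝ} (hh : h ∈ BlockFields (components K)) {ℓ k : Fin n}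
    (hne : K ℓ k ≠ 0) : h ℓ = h k := by
  obtain ⟨A, hA, hℓ⟩ := exists_block K ℓ
  exact hh A hA ℓ hℓ k ((mem_block_iff_of_pos hKs hA ((hK0 ℓ k).lt_of_ne' hne)).1 hℓ)

theorem collide_gibbs (hn : 0 < n) (J : Matrix (Fin n) (Fin n) ℝ)
    {K : Matrix (Fin n) (Fin n) ℝ} (hKs : K.IsSymm) (hK0 : ∀ i j, 0 ≤ K i j)
    (hK : ∀ i, ∑ j, K i j = 1) {h : Fin n → ℝ} (hh : h ∈ BlockFields (components K)) :
    collide J K (gibbs J h) (gibbs J h) = gibbs J h := by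
  refine collide_eq_self_of_pairDensity hn hKs hK (gibbs_mem_prob J h).2 fun ℓ k hne z => ?_
  have := sum_field_exchange (field_eq_of_ne_zero hKs hK0 hh hne) z
  simp only [pairDensity, gibbs_div_gibbs]
  rw [mul_mul_mul_comm, ← Real.exp_add, this, mul_mul_mul_comm, ← Real.exp_add]

/-- A positive probability vector in detailed balance is a Gibbs measure with a block field. -/
theorem exists_field_of_pairDensity {J K : Matrix (Fin n) (Fin n) ℝ}
    (hK : ∀ i, ∑ j, K i j = 1) {q : Config n → ℝ}
    (hq : ∑ σ, q σ = 1) (hpos : ∀ σ, 0 < q σ)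
    (hr : ∀ ℓ k, 0 < K ℓ k → ∀ z, pairDensity J q (exchange ℓ k z) = pairDensity J q z) :
    ∃ h ∈ BlockFields (components K), q = gibbs J h := by
  have hμ := gibbs_pos J 0
  set g : Config n → ℝ := fun σ => Real.log (q σ / gibbs J 0 σ) with hg
  have hlog : ∀ z, Real.log (pairDensity J q z) = g z.1 + g z.2 := fun z =>
    Real.log_mul (div_pos (hpos _) (hμ _)).ne' (div_pos (hpos _) (hμ _)).ne'
  set D : Fin n → Config n → ℝ := fun ℓ σ =>
    g (Function.update σ ℓ 1) - g (Function.update σ ℓ (-1)) with hD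
  -- Detailed balance for the pair with spin `1` at `ℓ` and `-1` at `k` equates the two flip
  -- increments. As `σ` and `σ'` are arbitrary, the increment does not depend on the configuration.
  have hDD : ∀ ℓ k, 0 < K ℓ k → ∀ σ σ', D ℓ σ = D k σ' := by
    intro ℓ k hℓk σ σ'
    have h1 := congrArg Real.log
      (hr ℓ k hℓk (Function.update σ ℓ 1, Function.update σ' k (-1)))
    rw [hlog, hlog] at h1
    simp only [exchange, setSpin, Function.update_self, Function.update_idem] at h1
    simp only [hD]
    linarith
  -- Raising a spin from `-1` to `1` changes the field energy by twice the field, hence the half.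
  set h : Fin n → ℝ := fun ℓ => D ℓ 1 / 2 with hh
  have hDh : ∀ ℓ σ, D ℓ σ = 2 * h ℓ := by
    intro ℓ σ
    obtain ⟨k, hk⟩ := exists_pos_of_sum_eq_one hK ℓ
    have h1 := hDD ℓ k hk σ 1
    have h2 := hDD ℓ k hk 1 1
    simp only [hh]
    linarith
  have hconst : ∀ τ, g τ - ∑ i, h i * spin τ i = g 1 - ∑ i, h i * spin 1 i := by
    refine fun τ => mem_of_forall_update_mem
      (S := {τ | g τ - ∑ i, h i * spin τ i = g 1 - ∑ i, h i * spin 1 i})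
      (fun σ hσ i a => ?_) (σ := 1) rfl τ
    have key : ∀ a b : ℤˣ, g (Function.update σ i a) - ∑ j, h j * spin (Function.update σ i a) j =
        g (Function.update σ i b) - ∑ j, h j * spin (Function.update σ i b) j := by
      have h1 := hDh i σ
      simp only [hD] at h1
      intro a b
      simp only [sum_field_update]
      rcases Int.units_eq_one_or a with rfl | rfl <;> rcases Int.units_eq_one_or b with rfl | rfl <;>
        push_cast <;> linarith
    have h2 := key a (σ i)
    rw [Function.update_eq_self] at h2
    exact h2.trans hσ
  refine ⟨h, fun A hA i hi j hj => ?_, ?_⟩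
  · have hreach := ((rel_of_mem_block hA hi).1 hj).1
    clear hj
    induction hreach with
    | refl => rfl
    | tail _ hbc ih => rw [ih]; simp only [hh]; rw [hDD _ _ hbc 1 1]
  · refine eq_gibbs_of_eq_mul hq (Real.exp (g 1 - ∑ i, h i * spin 1 i) /
      ∑ τ, isingWeight J 0 τ) fun σ => ?_
    have h1 : q σ / gibbs J 0 σ = Real.exp (g 1 - ∑ i, h i * spin 1 i) *
        Real.exp (∑ i, h i * spin σ i) := by
      rw [← Real.exp_add, ← hconst σ, sub_add_cancel, Real.exp_log (div_pos (hpos _) (hμ _))]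
    rw [div_eq_iff (hμ σ).ne'] at h1
    rw [h1, isingWeight_eq J h σ, gibbs]
    ring

/-! ### The magnetization profile determines the field -/

theorem sum_mul_field_eq (p d : Config n → ℝ) (h : Fin n → ℝ)
    (hd : ∀ σ, d σ = ∑ i, h i * spin σ i) :
    ∑ σ, p σ * d σ = ∑ i, h i * ∑ σ, p σ * spin σ i := by
  simp only [hd, Finset.mul_sum]
  rw [Finset.sum_comm]
  exact Finset.sum_congr rfl fun _ _ => Finset.sum_congr rfl fun _ _ => by ring

theorem sum_spin_eq_of_magnetization {p q : Config n → ℝ} {A : Finset (Fin n)} (hA : A.Nonempty)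
    (h : magnetization p A = magnetization q A) :
    ∑ i ∈ A, ∑ σ, p σ * spin σ i = ∑ i ∈ A, ∑ σ, q σ * spin σ i := by
  have hc : (1 / (A.card : ℝ)) ≠ 0 := by
    have : (A.card : ℝ) ≠ 0 := by exact_mod_cast hA.card_pos.ne'
    positivity
  exact mul_left_cancel₀ hc h

theorem sum_field_eq_of_magProfile {𝒜 : Finpartition (Finset.univ : Finset (Fin n))}
    {p q : Config n → ℝ} (hpq : magProfile 𝒜 p = magProfile 𝒜 q) {d : Fin n → ℝ}
    (hd : d ∈ BlockFields 𝒜) :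
    ∑ i, d i * ∑ σ, p σ * spin σ i = ∑ i, d i * ∑ σ, q σ * spin σ i := by
  classical
  have hsum : ∀ f : Fin n → ℝ, ∑ i, f i = ∑ A ∈ 𝒜.parts, ∑ i ∈ A, f i := by
    intro f
    conv_lhs => rw [← 𝒜.biUnion_parts]
    exact Finset.sum_biUnion 𝒜.disjoint
  rw [hsum, hsum]
  refine Finset.sum_congr rfl fun A hA => ?_
  obtain ⟨i₀, hi₀⟩ := 𝒜.nonempty_of_mem_parts hA
  have h1 := sum_spin_eq_of_magnetization (𝒜.nonempty_of_mem_parts hA) (congrFun hpq ⟨A, hA⟩)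
  calc _ = ∑ i ∈ A, d i₀ * ∑ σ, p σ * spin σ i :=
        Finset.sum_congr rfl fun i hi => by rw [hd A hA i hi i₀ hi₀]
    _ = ∑ i ∈ A, d i₀ * ∑ σ, q σ * spin σ i := by rw [← Finset.mul_sum, h1, Finset.mul_sum]
    _ = _ := Finset.sum_congr rfl fun i hi => by rw [hd A hA i hi i₀ hi₀]

theorem log_gibbs (J : Matrix (Fin n) (Fin n) ℝ) (h : Fin n → ℝ) (σ : Config n) :
    Real.log (gibbs J h σ) = Real.log (isingWeight J 0 σ) + ∑ i, h i * spin σ i -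
      Real.log (∑ τ, isingWeight J h τ) := by
  rw [gibbs, Real.log_div (isingWeight_pos J h σ).ne' (partition_pos J h).ne', isingWeight_eq J h σ,
    Real.log_mul (isingWeight_pos J 0 σ).ne' (Real.exp_pos _).ne', Real.log_exp]

theorem sub_mul_log_sub_log_nonneg {a b : ℝ} (ha : 0 < a) (hb : 0 < b) :
    0 ≤ (a - b) * (Real.log a - Real.log b) := by
  rcases le_total a b with h | h
  · exact mul_nonneg_of_nonpos_of_nonpos (sub_nonpos.2 h) (sub_nonpos.2 (Real.log_le_log ha h))
  · exact mul_nonneg (sub_nonneg.2 h) (sub_nonneg.2 (Real.log_le_log hb h))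

theorem eq_of_sub_mul_log_sub_log_eq_zero {a b : ℝ} (ha : 0 < a) (hb : 0 < b)
    (h : (a - b) * (Real.log a - Real.log b) = 0) : a = b := by
  rcases mul_eq_zero.1 h with h | h
  · exact sub_eq_zero.1 h
  · exact Real.log_injOn_pos ha hb (sub_eq_zero.1 h)

/-- A block field is determined by the magnetization profile of its Gibbs measure. -/
theorem field_eq_of_magProfile {𝒜 : Finpartition (Finset.univ : Finset (Fin n))}
    {J : Matrix (Fin n) (Fin n) ℝ} {h h' : Fin n → ℝ} (hh : h ∈ BlockFields 𝒜)
    (hh' : h' ∈ BlockFields 𝒜) (hm : magProfile 𝒜 (gibbs J h) = magProfile 𝒜 (gibbs J h')) :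
    h = h' := by
  have hd : h - h' ∈ BlockFields 𝒜 := fun A hA i hi j hj => by
    simp [hh A hA i hi j hj, hh' A hA i hi j hj]
  set c : ℝ := Real.log (∑ τ, isingWeight J h' τ) - Real.log (∑ τ, isingWeight J h τ) with hc
  have hlog : ∀ σ, Real.log (gibbs J h σ) - Real.log (gibbs J h' σ) =
      ∑ i, (h - h') i * spin σ i + c := by
    intro σ
    simp only [log_gibbs, Pi.sub_apply, sub_mul, Finset.sum_sub_distrib, hc]
    ring
  -- The symmetrized relative entropy of the two Gibbs measures is `h - h'` paired with the
  -- difference of their magnetizations, which vanishes for a block field.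
  have hzero : ∑ σ, (gibbs J h σ - gibbs J h' σ) *
      (Real.log (gibbs J h σ) - Real.log (gibbs J h' σ)) = 0 := by
    simp only [hlog, mul_add, sub_mul, Finset.sum_add_distrib, Finset.sum_sub_distrib,
      ← Finset.sum_mul, (gibbs_mem_prob J h).2, (gibbs_mem_prob J h').2]
    rw [sum_mul_field_eq _ _ (h - h') fun _ => rfl, sum_mul_field_eq _ _ (h - h') fun _ => rfl,
      sum_field_eq_of_magProfile hm hd]
    ring
  rw [Finset.sum_eq_zero_iff_of_nonneg fun σ _ =>
    sub_mul_log_sub_log_nonneg (gibbs_pos J h σ) (gibbs_pos J h' σ)] at hzero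
  have heq : ∀ σ, ∑ i, (h - h') i * spin σ i + c = 0 := fun σ => by
    rw [← hlog, eq_of_sub_mul_log_sub_log_eq_zero (gibbs_pos J h σ) (gibbs_pos J h' σ)
      (hzero σ (Finset.mem_univ σ)), sub_self]
  -- Flipping the single spin `i` in an affine function that vanishes identically isolates its
  -- coefficient.
  funext i
  have h1 := heq 1
  have h2 := heq (Function.update 1 i (-1))
  rw [sum_field_update] at h2
  simp only [spin, Pi.one_apply, Pi.sub_apply] at h1 h2
  push_cast at h1 h2
  linarith

/-! ### Well-posedness of the Cauchy problem -/

/-- Global solvability of the relaxation equation `du/dt = G u - u` for bounded Lipschitz `G`. -/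
theorem exists_relaxation_solution {E : Type*} [NormedAddCommGroup E] [NormedSpace ℝ E]
    [CompleteSpace E] {G : E → E} {L M : NNReal} (hG : LipschitzWith L G) (hM : ∀ x, ‖G x‖ ≤ M)
    (x₀ : E) {T : ℝ} (hT : 0 ≤ T) :
    ∃ u : ℝ → E, u 0 = x₀ ∧
      ∀ t ∈ Set.Icc 0 T, HasDerivWithinAt u (G (u t) - u t) (Set.Icc 0 T) t := by
  set T' : NNReal := ⟨T, hT⟩
  set B : NNReal := ⟨Real.exp T, (Real.exp_pos T).le⟩ * M with hB
  -- The substitution `v = eᵗ u` removes the term `-u`. The new field is bounded by `B = e^T M`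
  -- everywhere, so the radius `B T` serves the whole interval without a smallness condition; the
  -- exponentials cancel in the Lipschitz constant.
  have hpl : IsPicardLindelof (fun t x => Real.exp t • G (Real.exp (-t) • x))
      (⟨0, le_rfl, hT⟩ : Set.Icc (0 : ℝ) T) x₀ (B * T') 0 B L := by
    refine ⟨fun t _ => LipschitzWith.lipschitzOnWith (LipschitzWith.of_dist_le_mul fun x y => ?_),
      fun x _ => ?_, fun t ht x _ => ?_, ?_⟩
    · rw [dist_smul₀, Real.norm_of_nonneg (Real.exp_pos t).le]
      calc Real.exp t * dist (G (Real.exp (-t) • x)) (G (Real.exp (-t) • y))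
          ≤ Real.exp t * (L * dist (Real.exp (-t) • x) (Real.exp (-t) • y)) := by
            gcongr; exact hG.dist_le_mul _ _
        _ = Real.exp t * Real.exp (-t) * (L * dist x y) := by
            rw [dist_smul₀, Real.norm_of_nonneg (Real.exp_pos _).le]; ring
        _ = L * dist x y := by rw [← Real.exp_add]; simp
    · exact (Real.continuous_exp.smul (hG.continuous.comp (by fun_prop))).continuousOn
    · rw [norm_smul, Real.norm_of_nonneg (Real.exp_pos t).le, hB]
      exact mul_le_mul (Real.exp_le_exp.2 ht.2) (hM _) (norm_nonneg _) (Real.exp_pos T).le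
    · have h : ((B * T' : NNReal) : ℝ) = B * T := NNReal.coe_mul _ _
      simp [hT, h]
  obtain ⟨v, hv0, hv⟩ := hpl.exists_eq_forall_mem_Icc_hasDerivWithinAt₀
  refine ⟨fun t => Real.exp (-t) • v t, by simpa using hv0, fun t ht => ?_⟩
  have h1 : HasDerivWithinAt (fun t : ℝ => Real.exp (-t)) (-Real.exp (-t)) (Set.Icc 0 T) t := by
    simpa using ((hasDerivAt_neg t).exp).hasDerivWithinAt
  refine (h1.smul (hv t ht)).congr_deriv ?_
  rw [smul_smul, ← Real.exp_add]
  simp [sub_eq_add_neg]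

theorem contDiff_collide (J K : Matrix (Fin n) (Fin n) ℝ) :
    ContDiff ℝ 1 (fun x : Config n → ℝ => collide J K x x) := by
  rw [contDiff_pi]
  intro τ
  simp only [collide_self]
  fun_prop

theorem exists_lipschitzOnWith_collide (J K : Matrix (Fin n) (Fin n) ℝ) :
    ∃ L, LipschitzOnWith L (fun x : Config n → ℝ => collide J K x x) (Set.Icc 0 1) :=
  ((contDiff_collide J K).locallyLipschitz.locallyLipschitzOn).exists_lipschitzOnWith_of_compact
    isCompact_Icc

theorem prob_subset_Icc : Prob n ⊆ Set.Icc (0 : Config n → ℝ) 1 := fun _ hx =>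
  ⟨hx.1, fun σ => (Finset.single_le_sum (fun τ _ => hx.1 τ) (Finset.mem_univ σ)).trans_eq hx.2⟩

/-- Continuous dependence on the initial state. -/
theorem exists_dist_le (J K : Matrix (Fin n) (Fin n) ℝ) :
    ∃ L : NNReal, ∀ (T : ℝ) (u v : ℝ → Config n → ℝ),
      (∀ t ∈ Set.Icc 0 T, u t ∈ Prob n) →
      (∀ t ∈ Set.Icc 0 T,
        HasDerivWithinAt u (collide J K (u t) (u t) - u t) (Set.Icc 0 T) t) →
      (∀ t ∈ Set.Icc 0 T, v t ∈ Prob n) →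
      (∀ t ∈ Set.Icc 0 T,
        HasDerivWithinAt v (collide J K (v t) (v t) - v t) (Set.Icc 0 T) t) →
      ∀ t ∈ Set.Icc 0 T, dist (u t) (v t) ≤ dist (u 0) (v 0) * Real.exp (L * t) := by
  obtain ⟨L, hL⟩ := exists_lipschitzOnWith_collide J K
  refine ⟨L + 1, fun T u v hu hu' hv hv' t ht => ?_⟩
  have hright : ∀ t ∈ Set.Ico 0 T, Set.Icc 0 T ∈ 𝓝[Set.Ici t] t := fun t ht =>
    Icc_mem_nhdsGE_of_mem ht
  have := dist_le_of_trajectories_ODE_of_mem (v := fun _ x => collide J K x x - x)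
    (s := fun _ => Prob n) (K := L + 1) (a := 0) (b := T)
    (fun t _ => (hL.mono prob_subset_Icc).sub LipschitzWith.id.lipschitzOnWith)
    (fun t ht => (hu' t ht).continuousWithinAt)
    (fun t ht => (hu' t (Set.Ico_subset_Icc_self ht)).mono_of_mem_nhdsWithin (hright t ht))
    (fun t ht => hu t (Set.Ico_subset_Icc_self ht))
    (fun t ht => (hv' t ht).continuousWithinAt)
    (fun t ht => (hv' t (Set.Ico_subset_Icc_self ht)).mono_of_mem_nhdsWithin (hright t ht))
    (fun t ht => hv t (Set.Ico_subset_Icc_self ht)) le_rfl t ht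
  simpa using this

/-- Truncation of all coordinates to the unit interval. -/
def clip (x : Config n → ℝ) : Config n → ℝ := fun σ => max (min (x σ) 1) 0

theorem clip_mem (x : Config n → ℝ) : clip x ∈ Set.Icc (0 : Config n → ℝ) 1 :=
  ⟨fun _ => le_max_right _ _, fun _ => max_le (min_le_right _ _) zero_le_one⟩

theorem clip_eq_self {x : Config n → ℝ} (hx : x ∈ Set.Icc (0 : Config n → ℝ) 1) : clip x = x := by
  funext σ
  have h1 : x σ ≤ 1 := hx.2 σ
  have h0 : 0 ≤ x σ := hx.1 σ
  rw [clip, min_eq_left h1, max_eq_left h0]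

theorem lipschitzWith_clip : LipschitzWith 1 (clip : (Config n → ℝ) → Config n → ℝ) :=
  LipschitzWith.mk_one fun x y => by
    rw [dist_pi_le_iff dist_nonneg]
    intro σ
    have h := ((LipschitzWith.id.min_const (1 : ℝ)).max_const 0).dist_le_mul (x σ) (y σ)
    rw [NNReal.coe_one, one_mul] at h
    exact h.trans (dist_le_pi_dist x y σ)

theorem clip_le {x : Config n → ℝ} (hx : ∀ σ, 0 ≤ x σ) (σ : Config n) : clip x σ ≤ x σ :=
  max_le (min_le_left _ _) (hx σ)

theorem hasDerivWithinAt_exp_mul {f : ℝ → ℝ} {d t : ℝ} {s : Set ℝ}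
    (hf : HasDerivWithinAt f (d - f t) s t) :
    HasDerivWithinAt (fun t => Real.exp t * f t) (Real.exp t * d) s t := by
  refine ((Real.hasDerivAt_exp t).hasDerivWithinAt.mul hf).congr_deriv ?_
  ring

/-- The integrating factor absorbs the loss term, leaving the nonnegative gain. Nonnegativity and
positivity of coordinates propagate in this way. -/
theorem monotoneOn_exp_mul {T : ℝ} {f d : ℝ → ℝ}
    (hf : ∀ t ∈ Set.Icc 0 T, HasDerivWithinAt f (d t - f t) (Set.Icc 0 T) t)
    (hd : ∀ t ∈ Set.Icc 0 T, 0 ≤ d t) :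
    MonotoneOn (fun t => Real.exp t * f t) (Set.Icc 0 T) := by
  have h : ∀ t ∈ Set.Icc 0 T,
      HasDerivWithinAt (fun t => Real.exp t * f t) (Real.exp t * d t) (Set.Icc 0 T) t :=
    fun t ht => hasDerivWithinAt_exp_mul (hf t ht)
  exact monotoneOn_of_hasDerivWithinAt_nonneg (convex_Icc 0 T)
    (fun t ht => (h t ht).continuousWithinAt)
    (fun t ht => (h t (interior_subset ht)).mono interior_subset)
    (fun t ht => mul_nonneg (Real.exp_pos t).le (hd t (interior_subset ht)))

/-- A solution of `ds/dt = q - s` with `s 0 = 1` and `0 ≤ q ≤ s ^ 2` stays in `(0, 1]`. -/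
theorem mass_mem_Ioc {T : ℝ} {s q : ℝ → ℝ} (h0 : s 0 = 1)
    (hs : ∀ t ∈ Set.Icc 0 T, HasDerivWithinAt s (q t - s t) (Set.Icc 0 T) t)
    (hq0 : ∀ t ∈ Set.Icc 0 T, 0 ≤ q t) (hq : ∀ t ∈ Set.Icc 0 T, q t ≤ s t ^ 2) :
    ∀ t ∈ Set.Icc 0 T, s t ∈ Set.Ioc 0 1 := by
  have hpos : ∀ t ∈ Set.Icc 0 T, 0 < s t := by
    intro t ht
    have := monotoneOn_exp_mul hs hq0 ⟨le_rfl, ht.1.trans ht.2⟩ ht ht.1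
    simp only [h0, Real.exp_zero, one_mul] at this
    exact pos_of_mul_pos_right (one_pos.trans_le this) (Real.exp_pos t).le
  -- The reciprocal satisfies `(1/s)' = 1/s - q/s² ≥ 1/s - 1`, a linear inequality, so `1/s - 1`
  -- stays nonnegative.
  have h : ∀ t ∈ Set.Icc 0 T, HasDerivWithinAt (fun t => Real.exp (-t) * ((s t)⁻¹ - 1))
      (Real.exp (-t) * (1 - q t / s t ^ 2)) (Set.Icc 0 T) t := by
    intro t ht
    have hne := (hpos t ht).ne'
    have h1 : HasDerivWithinAt (fun t : ℝ => Real.exp (-t)) (-Real.exp (-t)) (Set.Icc 0 T) t := by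
      simpa using ((hasDerivAt_neg t).exp).hasDerivWithinAt
    refine (h1.mul (((hs t ht).inv hne).sub_const 1)).congr_deriv ?_
    simp only [Pi.inv_apply]
    field_simp
    ring
  have hmono := monotoneOn_of_hasDerivWithinAt_nonneg (convex_Icc 0 T)
    (fun t ht => (h t ht).continuousWithinAt)
    (fun t ht => (h t (interior_subset ht)).mono interior_subset)
    (fun t ht => mul_nonneg (Real.exp_pos _).le (sub_nonneg.2 (div_le_one_of_le₀
      (hq t (interior_subset ht)) (sq_nonneg _))))
  intro t ht
  refine ⟨hpos t ht, ?_⟩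
  have h1 := hmono ⟨le_rfl, ht.1.trans ht.2⟩ ht ht.1
  simp only [h0, inv_one, sub_self, mul_zero] at h1
  have h2 := nonneg_of_mul_nonneg_right h1 (Real.exp_pos _)
  exact (one_le_inv₀ (hpos t ht)).1 (sub_nonneg.1 h2)

/-- The equilibrium `s = 1` of `ds/dt = s ^ 2 - s` is not left from below. -/
theorem mass_eq_one {T : ℝ} {s : ℝ → ℝ} (h0 : s 0 = 1)
    (hs : ∀ t ∈ Set.Icc 0 T, HasDerivWithinAt s (s t ^ 2 - s t) (Set.Icc 0 T) t) :
    ∀ t ∈ Set.Icc 0 T, s t = 1 := by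
  have hmem := mass_mem_Ioc h0 hs (fun t _ => sq_nonneg _) (fun t _ => le_rfl)
  have h : ∀ t ∈ Set.Icc 0 T, HasDerivWithinAt (fun t => Real.exp (-t) * (s t - 1))
      (Real.exp (-t) * (1 - s t) ^ 2) (Set.Icc 0 T) t := by
    intro t ht
    have h1 : HasDerivWithinAt (fun t : ℝ => Real.exp (-t)) (-Real.exp (-t)) (Set.Icc 0 T) t := by
      simpa using ((hasDerivAt_neg t).exp).hasDerivWithinAt
    refine (h1.mul ((hs t ht).sub_const 1)).congr_deriv ?_
    ring
  have hmono := monotoneOn_of_hasDerivWithinAt_nonneg (convex_Icc 0 T)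
    (fun t ht => (h t ht).continuousWithinAt)
    (fun t ht => (h t (interior_subset ht)).mono interior_subset)
    (fun t ht => mul_nonneg (Real.exp_pos _).le (sq_nonneg _))
  intro t ht
  have h1 := hmono ⟨le_rfl, ht.1.trans ht.2⟩ ht ht.1
  simp only [h0, sub_self, mul_zero] at h1
  exact le_antisymm (hmem t ht).2 (sub_nonneg.1 (nonneg_of_mul_nonneg_right h1 (Real.exp_pos _)))

/-- Clipping the argument of the collision product gives a bounded Lipschitz field, hence a global
solution. The clip is then shown to be inactive: coordinates stay nonnegative, so clipping can only
lower the mass, the mass stays at most 1, and so does each coordinate. Only then does the mass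
equation close to `s' = s² - s`. -/
theorem exists_solution_Icc (hn : 0 < n) (J : Matrix (Fin n) (Fin n) ℝ)
    {K : Matrix (Fin n) (Fin n) ℝ} (hK0 : ∀ i j, 0 ≤ K i j) (hK : ∀ i, ∑ j, K i j = 1)
    {p : Config n → ℝ} (hp : p ∈ Prob n) {T : ℝ} (hT : 0 ≤ T) :
    ∃ u : ℝ → Config n → ℝ, u 0 = p ∧ (∀ t ∈ Set.Icc 0 T, u t ∈ Prob n) ∧
      ∀ t ∈ Set.Icc 0 T,
        HasDerivWithinAt u (collide J K (u t) (u t) - u t) (Set.Icc 0 T) t := by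
  obtain ⟨L, hL⟩ := exists_lipschitzOnWith_collide J K
  obtain ⟨M, hM⟩ := (isCompact_Icc.image_of_continuousOn
    (contDiff_collide J K).continuous.continuousOn : IsCompact ((fun x : Config n → ℝ =>
      collide J K x x) '' Set.Icc 0 1)).isBounded.exists_norm_le
  have hG : LipschitzWith (L * 1) (fun x : Config n → ℝ => collide J K (clip x) (clip x)) :=
    lipschitzOnWith_univ.1 (hL.comp lipschitzWith_clip.lipschitzOnWith fun x _ => clip_mem x)
  obtain ⟨u, hu0, hu⟩ := exists_relaxation_solution (M := M.toNNReal) hG (fun x =>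
    (hM _ ⟨clip x, clip_mem x, rfl⟩).trans (Real.le_coe_toNNReal M)) p hT
  have hcoord := fun t ht => hasDerivWithinAt_pi.1 (hu t ht)
  have hnn : ∀ t ∈ Set.Icc 0 T, ∀ σ, 0 ≤ u t σ := by
    intro t ht σ
    have := monotoneOn_exp_mul (f := fun t => u t σ)
      (d := fun t => collide J K (clip (u t)) (clip (u t)) σ) (fun t ht => hcoord t ht σ)
      (fun t _ => collide_nonneg hK0 (clip_mem _).1 σ) ⟨le_rfl, hT⟩ ht ht.1
    simp only [Real.exp_zero, one_mul, hu0] at this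
    exact nonneg_of_mul_nonneg_right ((hp.1 σ).trans this) (Real.exp_pos t)
  have hmass : ∀ t ∈ Set.Icc 0 T, HasDerivWithinAt (fun t => ∑ σ, u t σ)
      ((∑ σ, clip (u t) σ) ^ 2 - ∑ σ, u t σ) (Set.Icc 0 T) t := by
    intro t ht
    refine (HasDerivWithinAt.fun_sum fun σ (_ : σ ∈ Finset.univ) =>
      hcoord t ht σ).congr_deriv ?_
    simp only [Pi.sub_apply, Finset.sum_sub_distrib, sum_collide hn J hK]
  have hs0 : ∑ σ, u 0 σ = 1 := by rw [hu0]; exact hp.2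
  have hle := mass_mem_Ioc (s := fun t => ∑ σ, u t σ) hs0 hmass (fun t _ => sq_nonneg _)
    (fun t ht => pow_le_pow_left₀ (Finset.sum_nonneg fun σ _ => (clip_mem (u t)).1 σ)
      (Finset.sum_le_sum fun σ _ => clip_le (hnn t ht) σ) 2)
  have hclip : ∀ t ∈ Set.Icc 0 T, clip (u t) = u t := fun t ht => clip_eq_self ⟨hnn t ht,
    fun σ => (Finset.single_le_sum (fun τ _ => hnn t ht τ) (Finset.mem_univ σ)).trans (hle t ht).2⟩
  have hone := mass_eq_one (s := fun t => ∑ σ, u t σ) hs0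
    (fun t ht => (hmass t ht).congr_deriv (by rw [hclip t ht]))
  exact ⟨u, hu0, fun t ht => ⟨hnn t ht, hone t ht⟩,
    fun t ht => (hu t ht).congr_deriv (by rw [hclip t ht])⟩

theorem IsSolution.hasDerivWithinAt_Icc {J K : Matrix (Fin n) (Fin n) ℝ} {p : Config n → ℝ}
    {u : ℝ → Config n → ℝ} (hu : IsSolution J K p u) (T : ℝ) :
    ∀ t ∈ Set.Icc 0 T,
      HasDerivWithinAt u (collide J K (u t) (u t) - u t) (Set.Icc 0 T) t :=
  fun t ht => (hu.deriv t ht.1).mono Set.Icc_subset_Ici_self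

theorem IsSolution.exists_dist_le (J K : Matrix (Fin n) (Fin n) ℝ) :
    ∃ L : NNReal, ∀ {p q : Config n → ℝ} {u v : ℝ → Config n → ℝ}, IsSolution J K p u →
      IsSolution J K q v → ∀ t, 0 ≤ t → dist (u t) (v t) ≤ dist p q * Real.exp (L * t) := by
  obtain ⟨L, hL⟩ := IsingKinetic.exists_dist_le J K
  refine ⟨L, fun {p q u v} hu hv t ht => ?_⟩
  have := hL t u v (fun s hs => hu.mem_prob s hs.1) (hu.hasDerivWithinAt_Icc t)
    (fun s hs => hv.mem_prob s hs.1) (hv.hasDerivWithinAt_Icc t) t ⟨ht, le_rfl⟩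
  rwa [hu.initial, hv.initial] at this

theorem IsSolution.unique {J K : Matrix (Fin n) (Fin n) ℝ} {p : Config n → ℝ}
    {u v : ℝ → Config n → ℝ} (hu : IsSolution J K p u) (hv : IsSolution J K p v) {t : ℝ}
    (ht : 0 ≤ t) : v t = u t := by
  obtain ⟨L, hL⟩ := IsSolution.exists_dist_le J K
  simpa using hL hv hu t ht

theorem exists_isSolution (hn : 0 < n) (J : Matrix (Fin n) (Fin n) ℝ)
    {K : Matrix (Fin n) (Fin n) ℝ} (hK0 : ∀ i j, 0 ≤ K i j) (hK : ∀ i, ∑ j, K i j = 1)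
    {p : Config n → ℝ} (hp : p ∈ Prob n) : ∃ u, IsSolution J K p u := by
  choose w hw0 hwp hw using fun N : ℕ =>
    exists_solution_Icc hn J hK0 hK hp (T := (N : ℝ)) (Nat.cast_nonneg N)
  obtain ⟨L, hL⟩ := IsingKinetic.exists_dist_le J K
  have hagree : ∀ (N M : ℕ), N ≤ M → ∀ t ∈ Set.Icc (0 : ℝ) N, w N t = w M t := by
    intro N M hNM t ht
    have hsub : Set.Icc (0 : ℝ) N ⊆ Set.Icc 0 M := Set.Icc_subset_Icc_right (by exact_mod_cast hNM)
    simpa [hw0] using hL N (w N) (w M) (hwp N) (hw N) (fun t ht => hwp M t (hsub ht))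
      (fun t ht => (hw M t (hsub ht)).mono hsub) t ht
  set u : ℝ → Config n → ℝ := fun t => w (⌊t⌋₊ + 1) t with hu
  have huw : ∀ (N : ℕ), ∀ t ∈ Set.Icc (0 : ℝ) N, u t = w N t := by
    intro N t ht
    have hmem : t ∈ Set.Icc (0 : ℝ) ((⌊t⌋₊ + 1 : ℕ) : ℝ) :=
      ⟨ht.1, by push_cast; exact (Nat.lt_floor_add_one t).le⟩
    rcases le_total (⌊t⌋₊ + 1) N with h | h
    · exact hagree _ _ h t hmem
    · exact (hagree _ _ h t ht).symm
  refine ⟨u, fun t ht => ?_, ?_, fun t ht => ?_⟩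
  · obtain ⟨N, hN⟩ := exists_nat_ge t
    rw [huw N t ⟨ht, hN⟩]
    exact hwp N t ⟨ht, hN⟩
  · rw [huw 0 0 (by simp), hw0]
  -- Strict inequality makes `[0, N]` a neighbourhood of `t` within `[0, ∞)`, also when `t` is an
  -- integer.
  · obtain ⟨N, hN⟩ := exists_nat_gt t
    rw [huw N t ⟨ht, hN.le⟩]
    refine HasDerivWithinAt.mono_of_mem_nhdsWithin
      ((hw N t ⟨ht, hN.le⟩).congr (fun s hs => huw N s hs) (huw N t ⟨ht, hN.le⟩)) ?_
    rw [← Set.Ici_inter_Iic]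
    exact inter_mem self_mem_nhdsWithin (mem_nhdsWithin_of_mem_nhds (Iic_mem_nhds hN))

/-! ### Instantaneous positivity -/

theorem IsSolution.shift {J K : Matrix (Fin n) (Fin n) ℝ} {p : Config n → ℝ}
    {u : ℝ → Config n → ℝ} (hu : IsSolution J K p u) {s : ℝ} (hs : 0 ≤ s) :
    IsSolution J K (u s) (fun t => u (t + s)) := by
  refine ⟨fun t ht => hu.mem_prob _ (add_nonneg ht hs), by simp, fun t ht => ?_⟩
  have h1 : HasDerivWithinAt (fun t : ℝ => t + s) 1 (Set.Ici 0) t :=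
    (hasDerivWithinAt_id t _).add_const s
  exact ((hu.deriv (t + s) (add_nonneg ht hs)).scomp t h1
    (fun r (hr : 0 ≤ r) => add_nonneg hr hs)).congr_deriv (one_smul ℝ _)

theorem IsSolution.pos_of_initial_pos {J K : Matrix (Fin n) (Fin n) ℝ} (hK0 : ∀ i j, 0 ≤ K i j)
    {p : Config n → ℝ} {u : ℝ → Config n → ℝ} (hu : IsSolution J K p u) {σ : Config n}
    (hσ : 0 < p σ) {t : ℝ} (ht : 0 ≤ t) : 0 < u t σ := by
  have := monotoneOn_exp_mul (T := t) (f := fun t => u t σ)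
    (d := fun t => collide J K (u t) (u t) σ)
    (fun s hs => hasDerivWithinAt_pi.1 (hu.hasDerivWithinAt_Icc t s hs) σ)
    (fun s hs => collide_nonneg hK0 (hu.mem_prob s hs.1).1 σ) ⟨le_rfl, ht⟩ ⟨ht, le_rfl⟩ ht
  simp only [Real.exp_zero, one_mul, hu.initial] at this
  exact pos_of_mul_pos_right (hσ.trans_le this) (Real.exp_pos t).le

theorem IsSolution.pos_of_collide_pos {J K : Matrix (Fin n) (Fin n) ℝ}
    {p : Config n → ℝ} {u : ℝ → Config n → ℝ} (hu : IsSolution J K p u) {τ : Config n}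
    (hτ : ∀ t, 0 < t → 0 < collide J K (u t) (u t) τ) {t : ℝ} (ht : 0 < t) : 0 < u t τ := by
  have h : ∀ s ∈ Set.Icc 0 t, HasDerivWithinAt (fun s => Real.exp s * u s τ)
      (Real.exp s * collide J K (u s) (u s) τ) (Set.Icc 0 t) s := fun s hs =>
    hasDerivWithinAt_exp_mul (f := fun s => u s τ)
      (hasDerivWithinAt_pi.1 (hu.hasDerivWithinAt_Icc t s hs) τ)
  have hmono := strictMonoOn_of_hasDerivWithinAt_pos (convex_Icc 0 t)
    (fun s hs => (h s hs).continuousWithinAt)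
    (fun s hs => (h s (interior_subset hs)).mono interior_subset)
    (fun s hs => by
      rw [interior_Icc] at hs
      exact mul_pos (Real.exp_pos s) (hτ s hs.1))
  have h1 := hmono ⟨le_rfl, ht.le⟩ ⟨ht.le, le_rfl⟩ ht
  simp only [Real.exp_zero, one_mul] at h1
  exact pos_of_mul_pos_right (((hu.mem_prob 0 le_rfl).1 τ).trans_lt h1) (Real.exp_pos t).le

/-- If no charged configuration showed the value `a` in `A`, all spins there would equal `-a` and
the magnetization would be `±1`. -/
theorem exists_spin_of_magnetization {p : Config n → ℝ} (hp : p ∈ Prob n) {A : Finset (Fin n)}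
    (hA : A.Nonempty) (hm : magnetization p A ∈ Set.Ioo (-1 : ℝ) 1) (a : ℤˣ) :
    ∃ ℓ ∈ A, ∃ σ, 0 < p σ ∧ σ ℓ = a := by
  by_contra! hcon
  have h1 : ∀ ℓ ∈ A, ∑ σ, p σ * spin σ ℓ = -((a : ℤ) : ℝ) := by
    intro ℓ hℓ
    rw [← one_mul (-((a : ℤ) : ℝ)), ← hp.2, Finset.sum_mul]
    refine Finset.sum_congr rfl fun σ _ => ?_
    rcases (hp.1 σ).eq_or_lt with h | h
    · rw [← h, zero_mul, zero_mul]
    · rw [spin, Int.units_ne_iff_eq_neg.1 (hcon ℓ hℓ σ h)]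
      push_cast
      rfl
  have hc : (A.card : ℝ) ≠ 0 := by exact_mod_cast hA.card_pos.ne'
  rw [magnetization, Finset.sum_congr rfl h1, Finset.sum_const, nsmul_eq_mul, ← mul_assoc,
    one_div_mul_cancel hc, one_mul] at hm
  rcases Int.units_eq_one_or a with rfl | rfl <;> norm_num at hm

/-- Solutions with regular initial state are positive at positive times. -/
theorem IsSolution.pos (hn : 0 < n) {J K : Matrix (Fin n) (Fin n) ℝ} (hKs : K.IsSymm)
    (hK0 : ∀ i j, 0 ≤ K i j) (hK : ∀ i, ∑ j, K i j = 1) {p : Config n → ℝ}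
    (hp : p ∈ RegularProb (components K)) {u : ℝ → Config n → ℝ} (hu : IsSolution J K p u)
    {t : ℝ} (ht : 0 < t) (τ : Config n) : 0 < u t τ := by
  -- The configurations charged at all positive times are closed under exchanges, since the gain
  -- term of an allowed exchange is strictly positive.
  refine mem_of_exchange_closed hn hKs hK (S := {τ | ∀ t, 0 < t → 0 < u t τ})
    (fun ℓ k hℓk σ hσ σ' hσ' t ht => ?_) (fun A hA a => ?_) τ t ht
  · exact hu.pos_of_collide_pos (fun s hs => collide_pos_of_exchange hn hK0
      (hu.mem_prob s hs.le).1 hℓk (z := (σ, σ')) (hσ s hs) (hσ' s hs)) ht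
  · obtain ⟨ℓ, hℓ, σ, hσ, h⟩ := exists_spin_of_magnetization hp.1
      ((components K).nonempty_of_mem_parts hA) (hp.2 ⟨A, hA⟩) a
    exact ⟨ℓ, hℓ, σ, fun t ht => hu.pos_of_initial_pos hK0 hσ ht.le, h⟩

/-! ### Conservation laws -/

theorem IsSolution.sum_mul_eq (hn : 0 < n) {J K : Matrix (Fin n) (Fin n) ℝ} (hKs : K.IsSymm)
    (hK : ∀ i, ∑ j, K i j = 1) {p : Config n → ℝ} {u : ℝ → Config n → ℝ}
    (hu : IsSolution J K p u) {g : Config n → ℝ}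
    (hg : ∀ ℓ k, K ℓ k ≠ 0 → ∀ z, g (exchange ℓ k z).1 + g (exchange ℓ k z).2 = g z.1 + g z.2)
    {t : ℝ} (ht : 0 ≤ t) : ∑ σ, u t σ * g σ = ∑ σ, p σ * g σ := by
  have h : ∀ s, 0 ≤ s → HasDerivWithinAt (fun s => ∑ σ, u s σ * g σ) 0 (Set.Ici 0) s := by
    intro s hs
    refine (HasDerivWithinAt.fun_sum fun σ (_ : σ ∈ Finset.univ) =>
      (hasDerivWithinAt_pi.1 (hu.deriv s hs) σ).mul_const (g σ)).congr_deriv ?_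
    exact sum_collide_sub_mul_eq_zero hn J hKs hK (hu.mem_prob s hs).2 hg
  have := constant_of_has_deriv_right_zero (a := 0) (b := t)
    (fun s hs => ((h s hs.1).mono Set.Icc_subset_Ici_self).continuousWithinAt)
    (fun s hs => (h s hs.1).mono (Set.Ici_subset_Ici.2 hs.1)) t ⟨ht, le_rfl⟩
  simpa only [hu.initial] using this

/-- Conservation of the magnetization of each irreducible component. -/
theorem IsSolution.magnetization_eq (hn : 0 < n) {J K : Matrix (Fin n) (Fin n) ℝ}
    (hKs : K.IsSymm) (hK0 : ∀ i j, 0 ≤ K i j) (hK : ∀ i, ∑ j, K i j = 1) {p : Config n → ℝ}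
    {u : ℝ → Config n → ℝ} (hu : IsSolution J K p u) {A : Finset (Fin n)}
    (hA : A ∈ (components K).parts) {t : ℝ} (ht : 0 ≤ t) :
    magnetization (u t) A = magnetization p A := by
  set h : Fin n → ℝ := fun i => if i ∈ A then 1 else 0 with hh
  have hexch : ∀ ℓ k, K ℓ k ≠ 0 → h ℓ = h k := fun ℓ k hne => by
    simp only [hh, mem_block_iff_of_pos hKs hA ((hK0 ℓ k).lt_of_ne' hne)]
  have hobs := hu.sum_mul_eq hn hKs hK (g := fun σ => ∑ i, h i * spin σ i)
    (fun ℓ k hne z => sum_field_exchange (hexch ℓ k hne) z) ht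
  rw [sum_mul_field_eq _ _ h fun _ => rfl, sum_mul_field_eq _ _ h fun _ => rfl] at hobs
  simp only [hh, ite_mul, one_mul, zero_mul, Finset.sum_ite_mem, Finset.univ_inter] at hobs
  rw [magnetization, magnetization, hobs]

theorem IsSolution.magProfile_eq (hn : 0 < n) {J K : Matrix (Fin n) (Fin n) ℝ}
    (hKs : K.IsSymm) (hK0 : ∀ i j, 0 ≤ K i j) (hK : ∀ i, ∑ j, K i j = 1) {p : Config n → ℝ}
    {u : ℝ → Config n → ℝ} (hu : IsSolution J K p u) {t : ℝ} (ht : 0 ≤ t) :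
    magProfile (components K) (u t) = magProfile (components K) p :=
  funext fun A => hu.magnetization_eq hn hKs hK0 hK A.2 ht

/-! ### Free energy and entropy production -/

/-- The entropy functional relative to `μ_J`. -/
noncomputable def freeEnergy (J : Matrix (Fin n) (Fin n) ℝ) (q : Config n → ℝ) : ℝ :=
  ∑ σ, (q σ * Real.log (q σ) - q σ * Real.log (gibbs J 0 σ))

/-- Since `x log x` extends continuously by 0, states with zero coordinates are covered; compactness
arguments and the limit `t → 0` rely on this. -/
theorem continuous_freeEnergy (J : Matrix (Fin n) (Fin n) ℝ) : Continuous (freeEnergy J) :=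
  continuous_finsetSum _ fun σ _ =>
    (Real.continuous_mul_log.comp (continuous_apply σ)).sub ((continuous_apply σ).mul_const _)

theorem log_pairDensity {J : Matrix (Fin n) (Fin n) ℝ} {x : Config n → ℝ} (hx : ∀ σ, 0 < x σ)
    (z : Config n × Config n) : Real.log (pairDensity J x z) =
      Real.log (x z.1 / gibbs J 0 z.1) + Real.log (x z.2 / gibbs J 0 z.2) :=
  Real.log_mul (div_pos (hx _) (gibbs_pos J 0 _)).ne' (div_pos (hx _) (gibbs_pos J 0 _)).ne'

theorem pairDensity_pos {J : Matrix (Fin n) (Fin n) ℝ} {x : Config n → ℝ} (hx : ∀ σ, 0 < x σ)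
    (z : Config n × Config n) : 0 < pairDensity J x z :=
  mul_pos (div_pos (hx _) (gibbs_pos J 0 _)) (div_pos (hx _) (gibbs_pos J 0 _))

/-- The entropy production `x ↦ 𝒟(x, log (x / μ_J))`. -/
noncomputable def entropyProduction (J K : Matrix (Fin n) (Fin n) ℝ) (x : Config n → ℝ) : ℝ :=
  dissipation J K x fun σ => Real.log (x σ / gibbs J 0 σ)

theorem entropyProduction_eq {J K : Matrix (Fin n) (Fin n) ℝ} {x : Config n → ℝ}
    (hx : ∀ σ, 0 < x σ) : entropyProduction J K x =
      ∑ ℓ, ∑ k, K ℓ k * ∑ z : Config n × Config n, exchangeWeight J ℓ k z *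
        ((pairDensity J x z - pairDensity J x (exchange ℓ k z)) *
          (Real.log (pairDensity J x z) - Real.log (pairDensity J x (exchange ℓ k z)))) := by
  simp only [entropyProduction, dissipation, log_pairDensity hx]

theorem entropyProduction_term_nonneg {J : Matrix (Fin n) (Fin n) ℝ} {x : Config n → ℝ}
    (hx : ∀ σ, 0 < x σ) (ℓ k : Fin n) (z : Config n × Config n) : 0 ≤ exchangeWeight J ℓ k z *
      ((pairDensity J x z - pairDensity J x (exchange ℓ k z)) *
        (Real.log (pairDensity J x z) - Real.log (pairDensity J x (exchange ℓ k z)))) :=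
  mul_nonneg (exchangeWeight_pos J ℓ k z).le
    (sub_mul_log_sub_log_nonneg (pairDensity_pos hx z) (pairDensity_pos hx _))

theorem entropyProduction_nonneg {J K : Matrix (Fin n) (Fin n) ℝ} (hK0 : ∀ i j, 0 ≤ K i j)
    {x : Config n → ℝ} (hx : ∀ σ, 0 < x σ) : 0 ≤ entropyProduction J K x := by
  rw [entropyProduction_eq hx]
  exact Finset.sum_nonneg fun ℓ _ => Finset.sum_nonneg fun k _ => mul_nonneg (hK0 ℓ k)
    (Finset.sum_nonneg fun z _ => entropyProduction_term_nonneg hx ℓ k z)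

theorem pairDensity_exchange_of_entropyProduction_eq_zero {J K : Matrix (Fin n) (Fin n) ℝ}
    (hK0 : ∀ i j, 0 ≤ K i j) {x : Config n → ℝ} (hx : ∀ σ, 0 < x σ)
    (h : entropyProduction J K x = 0) (ℓ k : Fin n) (hℓk : 0 < K ℓ k) (z : Config n × Config n) :
    pairDensity J x (exchange ℓ k z) = pairDensity J x z := by
  have hin := fun i j => Finset.sum_nonneg fun z (_ : z ∈ Finset.univ) =>
    entropyProduction_term_nonneg (J := J) hx i j z
  rw [entropyProduction_eq hx, Finset.sum_eq_zero_iff_of_nonneg fun i _ =>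
    Finset.sum_nonneg fun j _ => mul_nonneg (hK0 i j) (hin i j)] at h
  have h1 := h ℓ (Finset.mem_univ _)
  rw [Finset.sum_eq_zero_iff_of_nonneg fun j _ => mul_nonneg (hK0 ℓ j) (hin ℓ j)] at h1
  have h2 := (mul_eq_zero.1 (h1 k (Finset.mem_univ _))).resolve_left hℓk.ne'
  rw [Finset.sum_eq_zero_iff_of_nonneg fun z _ => entropyProduction_term_nonneg hx ℓ k z] at h2
  have h3 := (mul_eq_zero.1 (h2 z (Finset.mem_univ _))).resolve_left (exchangeWeight_pos J ℓ k z).ne'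
  exact (eq_of_sub_mul_log_sub_log_eq_zero (pairDensity_pos hx z) (pairDensity_pos hx _) h3).symm

/-- The entropy dissipation identity. -/
theorem IsSolution.hasDerivAt_freeEnergy (hn : 0 < n) {J K : Matrix (Fin n) (Fin n) ℝ}
    (hKs : K.IsSymm) (hK : ∀ i, ∑ j, K i j = 1) {p : Config n → ℝ} {u : ℝ → Config n → ℝ}
    (hu : IsSolution J K p u) {t : ℝ} (ht : 0 < t) (hpos : ∀ σ, 0 < u t σ) :
    HasDerivAt (fun t => freeEnergy J (u t))
      (-(1 / (4 * (n : ℝ))) * entropyProduction J K (u t)) t := by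
  have hd := fun σ => hasDerivAt_pi.1 ((hu.deriv t ht.le).hasDerivAt (Ici_mem_nhds ht)) σ
  have hone := (hu.mem_prob t ht.le).2
  refine (HasDerivAt.fun_sum fun σ (_ : σ ∈ Finset.univ) =>
    ((hd σ).mul ((hd σ).log (hpos σ).ne')).sub ((hd σ).mul_const _)).congr_deriv ?_
  rw [entropyProduction, ← sum_collide_sub_mul hn J hKs hK hone, ← sub_eq_zero,
    ← Finset.sum_sub_distrib]
  -- Conservation of mass cancels the constant 1 in the derivative of `x log x`.
  have hzero : ∑ σ, (collide J K (u t) (u t) σ - u t σ) = 0 := by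
    rw [Finset.sum_sub_distrib, sum_collide hn J hK, hone]
    norm_num
  rw [← hzero]
  refine Finset.sum_congr rfl fun σ _ => ?_
  have := (hpos σ).ne'
  rw [Real.log_div this (gibbs_pos J 0 σ).ne']
  simp only [Pi.sub_apply]
  field_simp
  ring

theorem IsSolution.continuousOn {J K : Matrix (Fin n) (Fin n) ℝ} {p : Config n → ℝ}
    {u : ℝ → Config n → ℝ} (hu : IsSolution J K p u) : ContinuousOn u (Set.Ici 0) :=
  fun t ht => (hu.deriv t ht).continuousWithinAt

/-- The derivative is only needed for `t > 0`, where all coordinates are positive; continuity covers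
an initial state with zeros. -/
theorem IsSolution.antitoneOn_freeEnergy (hn : 0 < n) {J K : Matrix (Fin n) (Fin n) ℝ}
    (hKs : K.IsSymm) (hK0 : ∀ i j, 0 ≤ K i j) (hK : ∀ i, ∑ j, K i j = 1) {p : Config n → ℝ}
    (hp : p ∈ RegularProb (components K)) {u : ℝ → Config n → ℝ} (hu : IsSolution J K p u) :
    AntitoneOn (fun t => freeEnergy J (u t)) (Set.Ici 0) := by
  refine antitoneOn_of_hasDerivWithinAt_nonpos (convex_Ici 0)
    (f' := fun t => -(1 / (4 * (n : ℝ))) * entropyProduction J K (u t))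
    ((continuous_freeEnergy J).comp_continuousOn hu.continuousOn) (fun t ht => ?_) (fun t ht => ?_)
  all_goals
    rw [interior_Ici] at ht
    have hpos := hu.pos hn hKs hK0 hK hp ht
  · exact (hu.hasDerivAt_freeEnergy hn hKs hK ht hpos).hasDerivWithinAt
  · exact mul_nonpos_of_nonpos_of_nonneg (neg_nonpos.2 (by positivity))
      (entropyProduction_nonneg hK0 hpos)

/-- A regular state whose entropy is not decreased by the flow is a Gibbs measure. -/
theorem IsSolution.exists_field_of_freeEnergy_le (hn : 0 < n) {J K : Matrix (Fin n) (Fin n) ℝ}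
    (hKs : K.IsSymm) (hK0 : ∀ i j, 0 ≤ K i j) (hK : ∀ i, ∑ j, K i j = 1) {p : Config n → ℝ}
    (hp : p ∈ RegularProb (components K)) {u : ℝ → Config n → ℝ} (hu : IsSolution J K p u)
    (hF : freeEnergy J p ≤ freeEnergy J (u 1)) :
    ∃ h ∈ BlockFields (components K), p = gibbs J h := by
  have hanti := hu.antitoneOn_freeEnergy hn hKs hK0 hK hp
  have hconst : ∀ t ∈ Set.Icc (0 : ℝ) 1, freeEnergy J (u t) = freeEnergy J p := by
    intro t ht
    refine le_antisymm ?_ (hF.trans (hanti ht.1 (Set.mem_Ici.2 zero_le_one) ht.2))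
    have := hanti (Set.mem_Ici.2 le_rfl) ht.1 ht.1
    simpa only [hu.initial] using this
  have hgibbs : ∀ t ∈ Set.Ioo (0 : ℝ) 1, ∃ h ∈ BlockFields (components K), u t = gibbs J h := by
    intro t ht
    have hpos := hu.pos hn hKs hK0 hK hp ht.1
    have h1 := hu.hasDerivAt_freeEnergy hn hKs hK ht.1 hpos
    have h2 : HasDerivAt (fun t => freeEnergy J (u t)) 0 t :=
      (hasDerivAt_const t (freeEnergy J p)).congr_of_eventuallyEq
        (Filter.mem_of_superset (Icc_mem_nhds ht.1 ht.2) hconst)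
    have h3 := (mul_eq_zero.1 (h1.unique h2)).resolve_left (by
      have : (n : ℝ) ≠ 0 := by exact_mod_cast hn.ne'
      exact neg_ne_zero.2 (by positivity))
    exact exists_field_of_pairDensity hK (hu.mem_prob t ht.1.le).2 hpos
      (pairDensity_exchange_of_entropyProduction_eq_zero hK0 hpos h3)
  obtain ⟨h, hh, hhalf⟩ := hgibbs (1 / 2) (by norm_num)
  refine ⟨h, hh, ?_⟩
  -- Conservation of the profile makes the field independent of `t`, so letting `t → 0` identifies
  -- `p` itself.
  have hmem : ∀ᶠ t in 𝓝[>] (0 : ℝ), u t = gibbs J h := by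
    filter_upwards [Ioo_mem_nhdsGT (zero_lt_one (α := ℝ))] with t ht
    obtain ⟨h', hh', heq⟩ := hgibbs t ht
    rw [heq, field_eq_of_magProfile hh' hh]
    rw [← heq, ← hhalf, hu.magProfile_eq hn hKs hK0 hK ht.1.le,
      hu.magProfile_eq hn hKs hK0 hK (by norm_num)]
  have hlim : Tendsto u (𝓝[>] 0) (𝓝 (u 0)) :=
    (hu.continuousOn 0 (Set.mem_Ici.2 le_rfl)).mono_left (nhdsWithin_mono 0 Set.Ioi_subset_Ici_self)
  rw [← hu.initial]
  exact tendsto_nhds_unique hlim ((tendsto_congr' hmem).2 tendsto_const_nhds)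

/-! ### Existence of the field and convergence -/

theorem continuous_magProfile (𝒜 : Finpartition (Finset.univ : Finset (Fin n))) :
    Continuous (magProfile 𝒜 : (Config n → ℝ) → 𝒜.parts → ℝ) := by
  refine continuous_pi fun A => ?_
  simp only [magProfile, magnetization]
  fun_prop

theorem regular_of_magProfile_eq {𝒜 : Finpartition (Finset.univ : Finset (Fin n))}
    {p q : Config n → ℝ} (hp : p ∈ RegularProb 𝒜) (hq : q ∈ Prob n)
    (h : magProfile 𝒜 q = magProfile 𝒜 p) : q ∈ RegularProb 𝒜 :=
  ⟨hq, fun A => by rw [h]; exact hp.2 A⟩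

/-- The maximum entropy state with prescribed magnetization profile is a Gibbs measure. -/
theorem exists_field_magProfile_eq (hn : 0 < n) (J : Matrix (Fin n) (Fin n) ℝ)
    {K : Matrix (Fin n) (Fin n) ℝ} (hKs : K.IsSymm) (hK0 : ∀ i j, 0 ≤ K i j)
    (hK : ∀ i, ∑ j, K i j = 1) {p : Config n → ℝ} (hp : p ∈ RegularProb (components K)) :
    ∃ h ∈ BlockFields (components K),
      magProfile (components K) p = magProfile (components K) (gibbs J h) := by
  have hcomp : IsCompact (Prob n ∩ {q | magProfile (components K) q =
      magProfile (components K) p}) :=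
    (isCompact_stdSimplex ℝ (Config n)).inter_right
      (isClosed_eq (continuous_magProfile _) continuous_const)
  obtain ⟨q, ⟨hq, hqp⟩, hmin⟩ := hcomp.exists_isMinOn ⟨p, hp.1, rfl⟩
    (continuous_freeEnergy J).continuousOn
  -- The flow replaces a Lagrange multiplier argument: it preserves the profile, so `v 1` competes
  -- with the minimizer and cannot have lower free energy.
  obtain ⟨v, hv⟩ := exists_isSolution hn J hK0 hK hq
  obtain ⟨h, hh, rfl⟩ := hv.exists_field_of_freeEnergy_le hn hKs hK0 hK
    (regular_of_magProfile_eq hp hq hqp) (hmin ⟨hv.mem_prob 1 zero_le_one,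
      (hv.magProfile_eq hn hKs hK0 hK zero_le_one).trans hqp⟩)
  exact ⟨h, hh, hqp.symm⟩

theorem IsSolution.exists_tendsto_freeEnergy (hn : 0 < n) {J K : Matrix (Fin n) (Fin n) ℝ}
    (hKs : K.IsSymm) (hK0 : ∀ i j, 0 ≤ K i j) (hK : ∀ i, ∑ j, K i j = 1) {p : Config n → ℝ}
    (hp : p ∈ RegularProb (components K)) {u : ℝ → Config n → ℝ} (hu : IsSolution J K p u) :
    ∃ c, Tendsto (fun t => freeEnergy J (u t)) atTop (𝓝 c) := by
  have hanti : Antitone fun t : ℝ => freeEnergy J (u (max t 0)) := fun s t hst =>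
    hu.antitoneOn_freeEnergy hn hKs hK0 hK hp (Set.mem_Ici.2 (le_max_right s 0))
      (Set.mem_Ici.2 (le_max_right t 0)) (max_le_max_right 0 hst)
  obtain ⟨b, hb⟩ := (isCompact_stdSimplex ℝ (Config n)).bddBelow_image
    (continuous_freeEnergy J).continuousOn
  have hbdd : BddBelow (Set.range fun t : ℝ => freeEnergy J (u (max t 0))) :=
    ⟨b, by
      rintro _ ⟨t, rfl⟩
      exact hb ⟨_, hu.mem_prob _ (le_max_right t 0), rfl⟩⟩
  refine ⟨_, (tendsto_atTop_ciInf hanti hbdd).congr' ?_⟩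
  filter_upwards [eventually_ge_atTop (0 : ℝ)] with t ht
  rw [max_eq_left ht]

/-- Solutions with regular initial state converge to the Gibbs measure of the same profile. -/
theorem IsSolution.tendsto_gibbs (hn : 0 < n) {J K : Matrix (Fin n) (Fin n) ℝ}
    (hKs : K.IsSymm) (hK0 : ∀ i j, 0 ≤ K i j) (hK : ∀ i, ∑ j, K i j = 1) {p : Config n → ℝ}
    (hp : p ∈ RegularProb (components K)) {u : ℝ → Config n → ℝ} (hu : IsSolution J K p u)
    {h : Fin n → ℝ} (hh : h ∈ BlockFields (components K))
    (hm : magProfile (components K) p = magProfile (components K) (gibbs J h)) :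
    Tendsto u atTop (𝓝 (gibbs J h)) := by
  -- By compactness it suffices that every cluster point `q` of the trajectory is the expected Gibbs
  -- measure.
  refine (isCompact_stdSimplex ℝ (Config n)).tendsto_nhds_of_unique_mapClusterPt
    ((eventually_ge_atTop (0 : ℝ)).mono fun t ht => hu.mem_prob t ht) fun q hq hclus => ?_
  obtain ⟨U, hU, hUq⟩ := mapClusterPt_iff_ultrafilter.1 hclus
  have hnn : ∀ᶠ t in (U : Filter ℝ), 0 ≤ t := hU (eventually_ge_atTop 0)
  have hqp : magProfile (components K) q = magProfile (components K) p :=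
    tendsto_nhds_unique (((continuous_magProfile _).tendsto q).comp hUq)
      (tendsto_const_nhds.congr' (hnn.mono fun t ht => (hu.magProfile_eq hn hKs hK0 hK ht).symm))
  obtain ⟨c, hc⟩ := hu.exists_tendsto_freeEnergy hn hKs hK0 hK hp
  have hFq : freeEnergy J q = c :=
    tendsto_nhds_unique (((continuous_freeEnergy J).tendsto q).comp hUq) (hc.mono_left hU)
  obtain ⟨v, hv⟩ := exists_isSolution hn J hK0 hK hq
  obtain ⟨L, hL⟩ := IsSolution.exists_dist_le J K
  -- Continuous dependence: along `U`, the trajectory one unit of time later converges to the flow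
  -- of `q` at time 1, so both ends have the limiting free energy `c`.
  have hv1 : Tendsto (fun t => u (t + 1)) U (𝓝 (v 1)) := by
    rw [tendsto_iff_dist_tendsto_zero] at hUq ⊢
    have hb := hUq.mul_const (Real.exp (L * 1))
    rw [zero_mul] at hb
    refine squeeze_zero' (Eventually.of_forall fun _ => dist_nonneg) (hnn.mono fun t ht => ?_) hb
    simpa only [add_comm] using hL (hu.shift ht) hv 1 zero_le_one
  have hFv : freeEnergy J (v 1) = c :=
    tendsto_nhds_unique (((continuous_freeEnergy J).tendsto _).comp hv1)
      ((hc.comp (tendsto_atTop_add_const_right atTop 1 tendsto_id)).mono_left hU)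
  obtain ⟨h', hh', rfl⟩ := hv.exists_field_of_freeEnergy_le hn hKs hK0 hK
    (regular_of_magProfile_eq hp hq hqp) (hFq.trans hFv.symm).le
  rw [field_eq_of_magProfile hh' hh (hqp.trans hm)]

theorem tendsto_tvDist {u : ℝ → Config n → ℝ} {q : Config n → ℝ} (h : Tendsto u atTop (𝓝 q)) :
    Tendsto (fun t : ℝ => tvDist (u t) q) atTop (𝓝 0) := by
  have hc : Continuous fun p : Config n → ℝ => tvDist p q := by
    simp only [tvDist]
    fun_prop
  have := (hc.tendsto q).comp h
  simpa [tvDist, Function.comp_def] using this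

theorem isStationaryState_gibbs (hn : 0 < n) (J : Matrix (Fin n) (Fin n) ℝ)
    {K : Matrix (Fin n) (Fin n) ℝ} (hKs : K.IsSymm) (hK0 : ∀ i j, 0 ≤ K i j)
    (hK : ∀ i, ∑ j, K i j = 1) {h : Fin n → ℝ} (hh : h ∈ BlockFields (components K)) :
    IsStationaryState J K (gibbs J h) :=
  ⟨fun _ _ => gibbs_mem_prob J h, rfl, fun t _ => by
    rw [collide_gibbs hn J hKs hK0 hK hh, sub_self]
    exact hasDerivWithinAt_const t _ _⟩

end IsingKinetic

theorem theorem1p1 (n : ℕ) (hn : 0 < n) (J K : Matrix (Fin n) (Fin n) ℝ)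
    (hJ : J.IsSymm) (hKsymm : K.IsSymm) (hK : K ∈ Matrix.rowStochastic ℝ (Fin n)) :
    -- the Cauchy problem is well posed on the probability vectors
    (∀ p ∈ Prob n, ∃ u, IsSolution J K p u ∧
      ∀ v, IsSolution J K p v → ∀ t, 0 ≤ t → v t = u t) ∧
    -- characterization of the regular stationary states
    (∀ p ∈ RegularProb (components K),
      (IsStationaryState J K p ↔ ∃ h ∈ BlockFields (components K), p = gibbs J h)) ∧
    -- conservation laws
    (∀ p ∈ Prob n, ∀ u, IsSolution J K p u → ∀ A ∈ (components K).parts, ∀ t, 0 ≤ t →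
      magnetization (u t) A = magnetization p A) ∧
    -- convergence to the Gibbs measure with the unique matching block field
    (∀ p ∈ RegularProb (components K), ∃ h : Fin n → ℝ,
      (h ∈ BlockFields (components K) ∧
        magProfile (components K) p = magProfile (components K) (gibbs J h)) ∧
      (∀ h' ∈ BlockFields (components K),
        magProfile (components K) p = magProfile (components K) (gibbs J h') → h' = h) ∧
      ∀ u, IsSolution J K p u →
        Tendsto (fun t : ℝ => tvDist (u t) (gibbs J h)) atTop (𝓝 0)) := by
  have hK0 : ∀ i j, 0 ≤ K i j := fun i j => Matrix.nonneg_of_mem_rowStochastic hK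
  have hK1 : ∀ i, ∑ j, K i j = 1 := Matrix.sum_row_of_mem_rowStochastic hK
  refine ⟨fun p hp => ?_, fun p hp => ⟨fun hst => ?_, ?_⟩, fun p _ u hu A hA t ht => ?_,
    fun p hp => ?_⟩
  · obtain ⟨u, hu⟩ := exists_isSolution hn J hK0 hK1 hp
    exact ⟨u, hu, fun v hv t ht => hu.unique hv ht⟩
  -- Stationarity makes the constant curve the solution, whose free energy trivially does not drop.
  · exact IsSolution.exists_field_of_freeEnergy_le hn hKsymm hK0 hK1 hp hst le_rfl
  · rintro ⟨h, hh, rfl⟩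
    exact isStationaryState_gibbs hn J hKsymm hK0 hK1 hh
  · exact hu.magnetization_eq hn hKsymm hK0 hK1 hA ht
  · obtain ⟨h, hh, hm⟩ := exists_field_magProfile_eq hn J hKsymm hK0 hK1 hp
    exact ⟨h, ⟨hh, hm⟩, fun h' hh' hm' => field_eq_of_magProfile hh' hh (hm'.symm.trans hm),
      fun u hu => tendsto_tvDist (hu.tendsto_gibbs hn hKsymm hK0 hK1 hp hh hm)⟩
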